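/- An election consists of a set $C$ of $m$ candidates and a list of $n$ voters $v^1,\dots,v^n$; voter $v^i$ has a total preference order over $C$ and an approval count $\ell^i\in\{0,\dots,m\}$, and she approves of her top $\ell^i$ candidates. For a candidate $c$, the approval score is the number of voters approving $c$, and the round-$k$ score is the number of voters who approve $c$ and rank her in the top $k$ positions. The winning round, if it exists, is the least $k$ such that some candidate has round-$k$ score at least $\lfloor n/2\rfloor+1$. * SP-AV: the winners are the candidates with the highest approval score. * Fallback: if there is a winning round $k$, the winners are the candidates with the highest round-$k$ score; otherwise, those with the highest approval score. * Simplified Fallback: if there is a winning round $k$, the winners are all candidates with round-$k$ score at least $\lfloor n/2\rfloor+1$; otherwise, those with the highest approval score. An instance of *destructive support bribery* for a voting rule $\mathcal R$ consists of an election, a despised candidate $d\in C$, and for each voter $v^i$ a cost function $\sigma^i:\mathbb Z\to\{0,1,2,\dots\}\cup\{+\infty\}$ with $\sigma^i(0)=0$, $\sigma^i(k)\le\sigma^i(k+1)$ and $\sigma^i(-k)\le\sigma^i(-k-1)$ for all $k>0$, given by the list of its values on $-\ell^i,\dots,m-\ell^i$ (in binary). A bribery is a vector $\mathbf t\in\mathbb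 Z^n$; it replaces each approval count $\ell^i$ by $\ell^i+t_i$ (by $0$ or $m$ if this is below $0$ or above $m$), and costs $\sum_i\sigma^i(t_i)$. It is *successful* if $d$ is not an $\mathcal R$-winner of the resulting election. **Theorem.** For each $\mathcal R$ among SP-AV, simplified Fallback and Fallback, destructive support bribery for $\mathcal R$ is solvable in polynomial time: the problem of deciding, given an instance and a budget $b\in\{0,1,2,\dots\}$ (in binary), whether there is a successful bribery of cost at most $b$ is in $\mathrm P$; and there is a polynomial-time algorithm that, given an instance, outputs a successful bribery of minimum cost among all successful briberies, or reports that no successful bribery exists. -/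

import Mathlib

open Computability Turing

/-! ### Elections and voting rules -/

/-- An election with candidates `Fin m` and voters `Fin n`.  The preference order of voter `i` is
the list `pref i 0, pref i 1, …` of all candidates, from most to least preferred, and voter `i`
approves of the top `approval i` candidates of that list. -/
structure Election (m n : ℕ) where
  pref : Fin n → Equiv.Perm (Fin m)
  approval : Fin n → ℕ
  approval_le : ∀ i, approval i ≤ m

namespace Election

variable {m n : ℕ}

/-- The position (starting from `1`) of candidate `c` in the preference order of voter `i`. -/
def rank (E : Election m n) (c : Fin m) (i : Fin n) : ℕ :=
  ((E.pref i).symm c : ℕ) + 1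

/-- Voter `i` approves of candidate `c`. -/
def Approves (E : Election m n) (i : Fin n) (c : Fin m) : Prop :=
  E.rank c i ≤ E.approval i

instance (E : Election m n) (i : Fin n) (c : Fin m) : Decidable (E.Approves i c) :=
  inferInstanceAs (Decidable (E.rank c i ≤ E.approval i))

/-- The approval score of `c`: the number of voters that approve of `c`. -/
def approvalScore (E : Election m n) (c : Fin m) : ℕ :=
  (Finset.univ.filter fun i : Fin n => E.Approves i c).card

/-- The `k`-Approval score of `c` after each voter's non-approved candidates have been deleted from
her ranking: the number of voters that approve of `c` and rank her in the top `k` positions. -/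
def roundScore (E : Election m n) (k : ℕ) (c : Fin m) : ℕ :=
  (Finset.univ.filter fun i : Fin n => E.Approves i c ∧ E.rank c i ≤ k).card

/-- In the truncated election, a strict majority of all `n` voters ranks `c` in the top `k`
positions. -/
def HasMajority (E : Election m n) (k : ℕ) (c : Fin m) : Prop :=
  n / 2 + 1 ≤ E.roundScore k c

/-- `k` is the Bucklin winning round of the truncated election: the smallest round in which some
candidate has a strict majority. -/
def IsWinningRound (E : Election m n) (k : ℕ) : Prop :=
  IsLeast {k : ℕ | ∃ c, E.HasMajority k c} k

end Election

/-- A voting rule maps each election to its set of winners. -/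
def VotingRule : Type :=
  (m n : ℕ) → Election m n → Set (Fin m)

/-- SP-AV: the winners are the candidates with the highest approval score. -/
def spav : VotingRule := fun _ _ E =>
  {c | ∀ c', E.approvalScore c' ≤ E.approvalScore c}

/-- Fallback voting: the Bucklin rule applied to the truncated ballots, that is, the winners are
the candidates with the highest score in the winning round; if no candidate ever obtains a
majority, the candidates with the highest approval score win. -/
def fallback : VotingRule := fun m n E =>
  {c | (∃ k, E.IsWinningRound k ∧ ∀ c', E.roundScore k c' ≤ E.roundScore k c) ∨
    ((¬ ∃ k, E.IsWinningRound k) ∧ c ∈ spav m n E)}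

/-- Simplified Fallback voting: all candidates with a majority in the winning round win; if no
candidate ever obtains a majority, the candidates with the highest approval score win. -/
def simplifiedFallback : VotingRule := fun m n E =>
  {c | (∃ k, E.IsWinningRound k ∧ E.HasMajority k c) ∨
    ((¬ ∃ k, E.IsWinningRound k) ∧ c ∈ spav m n E)}

/-! ### Destructive support bribery -/

/-- The election after the push action `t`: voter `i` now approves of `approval i + t i`
candidates, where values below `0` or above `m` are replaced by `0` or `m`. -/
def Election.push {m n : ℕ} (E : Election m n) (t : Fin n → ℤ) : Election m n where
  pref := E.pref
  approval i := (max 0 (min (m : ℤ) (E.approval i + t i))).toNat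
  approval_le i := by omega

/-- An instance of destructive support bribery: an election, the support bribery cost functions
of its voters, with values in `{0, 1, 2, …} ∪ {∞}`, and the despised candidate. -/
structure BriberyInstance where
  m : ℕ
  n : ℕ
  election : Election m n
  cost : Fin n → ℤ → ℕ∞
  cost_zero : ∀ i, cost i 0 = 0
  cost_le_succ : ∀ i, ∀ k : ℤ, 0 < k → cost i k ≤ cost i (k + 1)
  cost_neg_le : ∀ i, ∀ k : ℤ, 0 < k → cost i (-k) ≤ cost i (-k - 1)
  despised : Fin m

namespace BriberyInstance

/-- The total cost of the push action `t`. -/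
noncomputable def totalCost (I : BriberyInstance) (t : Fin I.n → ℤ) : ℕ∞ :=
  ∑ i, I.cost i (t i)

/-- The push action `t` prevents the despised candidate from winning under the rule `R`. -/
def Prevents (R : VotingRule) (I : BriberyInstance) (t : Fin I.n → ℤ) : Prop :=
  I.despised ∉ R I.m I.n (I.election.push t)

/-- `t` is a solution of the optimization problem: it prevents the despised candidate from winning,
at the lowest cost among all push actions that do so. -/
def IsOptimal (R : VotingRule) (I : BriberyInstance) (t : Fin I.n → ℤ) : Prop :=
  I.Prevents R t ∧ ∀ s : Fin I.n → ℤ, I.Prevents R s → I.totalCost t ≤ I.totalCost s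

end BriberyInstance

/-- The decision variant: with budget `b`, can the despised candidate be prevented from winning? -/
def DestructiveSupportBribery (R : VotingRule) (Ib : BriberyInstance × ℕ) : Prop :=
  ∃ t : Fin Ib.1.n → ℤ, Ib.1.Prevents R t ∧ Ib.1.totalCost t ≤ (Ib.2 : ℕ∞)

/-- The search variant: `none` is a correct answer if no push action prevents the despised
candidate from winning, and a list of integers is a correct answer if it is an optimal push
action. -/
def IsCorrectAnswer (R : VotingRule) (I : BriberyInstance) : Option (List ℤ) → Prop
  | none => ∀ t : Fin I.n → ℤ, ¬ I.Prevents R t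
  | some l => ∃ t : Fin I.n → ℤ, l = List.ofFn t ∧ I.IsOptimal R t

/-! ### Encodings -/

/-- The alphabet for instances and answers. -/
inductive Symb : Type
  | bit (b : Bool)
  | mark
  | infinity
  | minus
  | sep
  | noAnswer

/-- Unary encoding, used only for numbers that are bounded by the number of candidates. -/
def encodeUnary (k : ℕ) : List Symb :=
  List.replicate k Symb.mark ++ [Symb.sep]

/-- Binary encoding of a cost or a budget, with a special symbol for `∞`. -/
noncomputable def encodeCost (x : ℕ∞) : List Symb :=
  (if x = ⊤ then [Symb.infinity] else (encodeNat x.toNat).map Symb.bit) ++ [Symb.sep]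

/-- The encoding of voter `i`: her preference order, her approval count `ℓ`, and the list of the
values of her cost function on `-ℓ, …, m - ℓ`. -/
noncomputable def encodeVoter (I : BriberyInstance) (i : Fin I.n) : List Symb :=
  (List.finRange I.m).flatMap (fun r => encodeUnary (I.election.pref i r)) ++
    encodeUnary (I.election.approval i) ++
    (List.range (I.m + 1)).flatMap
      (fun j => encodeCost (I.cost i ((j : ℤ) - (I.election.approval i : ℤ))))

/-- The encoding of an instance: the number of candidates, the despised candidate, and the
voters one after another. -/
noncomputable def encodeInstance (I : BriberyInstance) : List Symb :=
  encodeUnary I.m ++ encodeUnary I.despised ++ (List.finRange I.n).flatMap (encodeVoter I)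

/-- The encoding of an instance together with a budget, which is written in binary. -/
noncomputable def encodeInstanceBudget (Ib : BriberyInstance × ℕ) : List Symb :=
  encodeCost (Ib.2 : ℕ∞) ++ encodeInstance Ib.1

/-- Signed unary encoding of an integer. -/
def encodeInt (z : ℤ) : List Symb :=
  (if z < 0 then [Symb.minus] else []) ++ encodeUnary z.natAbs

/-- The encoding of the answers to the search problem. -/
def encodeAnswer : Option (List ℤ) → List Symb
  | none => [Symb.noAnswer]
  | some l => l.flatMap encodeInt

/-! ### Polynomial time -/

/-- The decision problem `p` on `α`, with inputs encoded by `enc`, is in P: a Turing machine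
decides it in time polynomial in the length of the encoded input. -/
def InP {α Γ : Type} (enc : α → List Γ) (p : α → Prop) : Prop :=
  ∃ f : α → Bool, (∀ a, f a = true ↔ p a) ∧
    Nonempty (TM2ComputableInPolyTime enc encodeBool f)

/-- The search problem `S` (where `S a y` says that `y` is a correct answer on input `a`) is
solvable in polynomial time by a Turing machine. -/
def SolvableInPolyTime {α β Γ Δ : Type} (enc : α → List Γ) (enc' : β → List Δ)
    (S : α → β → Prop) : Prop :=
  ∃ F : α → β, (∀ a, S a (F a)) ∧ Nonempty (TM2ComputableInPolyTime enc enc' F)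

/-! ### Structured programs over finitely many stacks -/

/-! Pushing a voter's approval count beyond `0` or `m` has the same effect as pushing it exactly
there and, the costs being monotone on either side of zero, is at least as expensive
(`exists_pushTo`). So a bribery is a choice of one count in `{0, …, m}` for each voter.

That `d` loses has a small certificate: a round `k` and a rival `c`. Let `x` be the score of `c` in
round `k`, and `y`, `z` the scores of `d` in rounds `k` and `k - 1`. In SP-AV, `d` loses iff `x > y`
for some `c` and `k = m`. In simplified Fallback, `d` loses iff for some `k` and `c` she has no
majority in round `k` and either `c` has one there, or `k = m` and `x > y`. In Fallback, `d` loses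
iff for some `k` and `c` we have `x > y` and either `c` has a majority in round `k` and `d` none in
round `k - 1`, or `k = m` and `d` has no majority in round `m`. The guessed `k` need not be the
winning round: a majority of `c` in round `k` forces a winning round at or before `k`, and scores
only grow with the round. If it comes strictly before `k`, then under Fallback `d` has no majority
there and someone else does. These equivalences are `decidesLosing_spav`,
`decidesLosing_simplifiedFallback` and `decidesLosing_fallback`.

For fixed `k` and `c`, each voter contributes `0` or `1` to each of `x`, `y`, `z`, and costs add up.
A dynamic program over the voters keeps one cheapest partial bribery for each reachable triple in
`{0, …, n}³` (`Entry.table`). Exchanging a partial bribery for a cheaper one with the same scores is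
harmless, whence optimality (`Entry.exists_mem_foldl_tableStep`). The answer is the cheapest
accepted entry over all `m²` pairs `(k, c)`.

For the Turing machine bound, data are coded as trees, written in preorder on one stack, and
structured stack programs are compiled to `TM2` machines. The resulting class `PolyTime` is closed
under composition, pairing, case distinction and left folds whose intermediate values stay
polynomially small. The algorithm is built from such list operations, so most of its time bounds are
found by `fun_prop`. Indices and scores are bounded by the input length and may be unary. Costs stay
binary, and digit strings grow additively over the voters, so the tables have polynomial size
(`Entry.size_foldl_tableStep_le`). -/

/-- Binary trees with atoms from the alphabet of instances and answers. -/
inductive DataTree : Type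
  | atom (s : Symb)
  | node (a b : DataTree)

namespace StackMachine

/-- Tokens of the preorder notation of a tree: `none` announces an inner node. -/
abbrev Tok : Type := Option Symb

/-- Auxiliary stacks. -/
inductive Tmp : Type
  | x | y | z
  deriving DecidableEq

/-- The stacks of the machine. -/
inductive Stk : Type
  | inp | outSymb | outBool | main | tmp (t : Tmp) | cnt
  deriving DecidableEq

instance : Fintype Stk :=
  ⟨{.inp, .outSymb, .outBool, .main, .tmp .x, .tmp .y, .tmp .z, .cnt}, fun k => by
    rcases k with _ | _ | _ | _ | t | _ <;> try simp
    cases t <;> simp⟩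

/-- The alphabet of each stack. -/
abbrev Alph : Stk → Type
  | .inp => Symb
  | .outSymb => Symb
  | .outBool => Bool
  | .main => Tok
  | .tmp _ => Tok
  | .cnt => Tok

/-- The finite memory of the machine holds the token read last. -/
abbrev Mem : Type := Option Tok

/-- Structured programs. -/
inductive Prog : Type
  | push (k : Stk) (f : Mem → Alph k)
  | pop (k : Stk) (f : Mem → Option (Alph k) → Mem)
  | load (f : Mem → Mem)
  | seq (p q : Prog)
  | ite (b : Mem → Bool) (p q : Prog)
  | loop (b : Mem → Bool) (p : Prog)

namespace Prog

/-- The labels of the machine code of a program. -/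
def Lab : Prog → Type
  | push _ _ => Unit
  | pop _ _ => Unit
  | load _ => Unit
  | seq p q => p.Lab ⊕ q.Lab
  | ite _ p q => Option (p.Lab ⊕ q.Lab)
  | loop _ p => Option p.Lab

@[reducible]
noncomputable def fintypeLab : (p : Prog) → Fintype p.Lab
  | push _ _ => inferInstanceAs (Fintype Unit)
  | pop _ _ => inferInstanceAs (Fintype Unit)
  | load _ => inferInstanceAs (Fintype Unit)
  | seq p q =>
    letI := p.fintypeLab; letI := q.fintypeLab; inferInstanceAs (Fintype (p.Lab ⊕ q.Lab))
  | ite _ p q =>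
    letI := p.fintypeLab; letI := q.fintypeLab
    inferInstanceAs (Fintype (Option (p.Lab ⊕ q.Lab)))
  | loop _ p => letI := p.fintypeLab; inferInstanceAs (Fintype (Option p.Lab))

/-- The label at which the execution of a program starts. -/
def entry : (p : Prog) → p.Lab
  | push _ _ => ()
  | pop _ _ => ()
  | load _ => ()
  | seq p _ => Sum.inl p.entry
  | ite _ _ _ => none
  | loop _ _ => none

/-- The machine code of a program, with labels embedded by `i`, that jumps to `e` at the end. -/
def code {L : Type} : (p : Prog) → (p.Lab → L) → L → p.Lab → TM2.Stmt Alph L Mem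
  | push k f, _, e, _ => .push k f (.goto fun _ => e)
  | pop k f, _, e, _ => .pop k f (.goto fun _ => e)
  | load f, _, e, _ => .load f (.goto fun _ => e)
  | seq p q, i, _, .inl l => p.code (fun l => i (.inl l)) (i (.inr q.entry)) l
  | seq _ q, i, e, .inr l => q.code (fun l => i (.inr l)) e l
  | ite b p q, i, _, none =>
    .branch b (.goto fun _ => i (some (.inl p.entry))) (.goto fun _ => i (some (.inr q.entry)))
  | ite _ p _, i, e, some (.inl l) => p.code (fun l => i (some (.inl l))) e l
  | ite _ _ q, i, e, some (.inr l) => q.code (fun l => i (some (.inr l))) e l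
  | loop b p, i, e, none => .branch b (.goto fun _ => i (some p.entry)) (.goto fun _ => e)
  | loop _ p, i, _, some l => p.code (fun l => i (some l)) (i none) l

end Prog

/-- The contents of the memory and of the stacks. -/
abbrev Store : Type := Mem × (∀ k, List (Alph k))

/-- The machine code of `p`, started on the store `s`, arrives at its end after at most `N` steps
with the store `s'`. -/
structure RunsIn (p : Prog) (s s' : Store) (N : ℕ) : Prop where
  exec : ∀ {L : Type} (M : L → TM2.Stmt Alph L Mem) (i : p.Lab → L) (e : L),
    (∀ l, M (i l) = p.code i e l) →
      ∃ n ≤ N, (flip bind (TM2.step M))^[n] (some ⟨some (i p.entry), s.1, s.2⟩) =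
        some ⟨some e, s'.1, s'.2⟩

/-! ### Execution rules for structured programs -/

namespace RunsIn

variable {p q : Prog} {s s' s'' : Store} {N N' : ℕ}

theorem mono (h : RunsIn p s s' N) (hN : N ≤ N') : RunsIn p s s' N' := by
  refine ⟨fun {L} M i e hM => ?_⟩
  obtain ⟨n, hn, h⟩ := h.exec M i e hM
  exact ⟨n, hn.trans hN, h⟩

theorem mono' (h : RunsIn p s s' N) (hs : s' = s'') (hN : N ≤ N') : RunsIn p s s'' N' :=
  hs ▸ h.mono hN

theorem push {k : Stk} {f : Mem → Alph k} {v : Mem} {S : ∀ k, List (Alph k)} :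
    RunsIn (.push k f) (v, S) (v, Function.update S k (f v :: S k)) 1 := by
  refine ⟨fun {L} M i e hM => ?_⟩
  refine ⟨1, le_rfl, ?_⟩
  simp [flip, hM, Prog.code]

theorem pop {k : Stk} {f : Mem → Option (Alph k) → Mem} {v : Mem} {S : ∀ k, List (Alph k)} :
    RunsIn (.pop k f) (v, S) (f v (S k).head?, Function.update S k (S k).tail) 1 := by
  refine ⟨fun {L} M i e hM => ?_⟩
  refine ⟨1, le_rfl, ?_⟩
  simp [flip, hM, Prog.code]

theorem load {f : Mem → Mem} {v : Mem} {S : ∀ k, List (Alph k)} :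
    RunsIn (.load f) (v, S) (f v, S) 1 := by
  refine ⟨fun {L} M i e hM => ?_⟩
  refine ⟨1, le_rfl, ?_⟩
  simp [flip, hM, Prog.code]

theorem seq (h : RunsIn p s s' N) (h' : RunsIn q s' s'' N') :
    RunsIn (.seq p q) s s'' (N + N') := by
  refine ⟨fun {L} M i e hM => ?_⟩
  obtain ⟨n, hn, h⟩ := h.exec M (fun l => i (.inl l)) (i (.inr q.entry)) (fun l => hM _)
  obtain ⟨n', hn', h'⟩ := h'.exec M (fun l => i (.inr l)) e (fun l => hM _)
  refine ⟨n' + n, by omega, ?_⟩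
  rw [Function.iterate_add_apply]
  exact (congrArg _ h).trans h'

theorem ite_true {b : Mem → Bool} (hb : b s.1 = true) (h : RunsIn p s s' N) :
    RunsIn (.ite b p q) s s' (N + 1) := by
  refine ⟨fun {L} M i e hM => ?_⟩
  obtain ⟨n, hn, h⟩ := h.exec M (fun l => i (some (.inl l))) e (fun l => hM _)
  refine ⟨n + 1, by omega, ?_⟩
  have h0 : M (i none) = _ := hM none
  rw [Function.iterate_add_apply, ← h]
  simp [flip, h0, Prog.code, Prog.entry, hb]

theorem ite_false {b : Mem → Bool} (hb : b s.1 = false) (h : RunsIn q s s' N) :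
    RunsIn (.ite b p q) s s' (N + 1) := by
  refine ⟨fun {L} M i e hM => ?_⟩
  obtain ⟨n, hn, h⟩ := h.exec M (fun l => i (some (.inr l))) e (fun l => hM _)
  refine ⟨n + 1, by omega, ?_⟩
  have h0 : M (i none) = _ := hM none
  rw [Function.iterate_add_apply, ← h]
  simp [flip, h0, Prog.code, Prog.entry, hb]

theorem loop_false {b : Mem → Bool} (hb : b s.1 = false) : RunsIn (.loop b p) s s 1 := by
  refine ⟨fun {L} M i e hM => ?_⟩
  have h0 : M (i none) = _ := hM none
  refine ⟨1, le_rfl, ?_⟩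
  simp [flip, h0, Prog.code, Prog.entry, hb]

theorem loop_true {b : Mem → Bool} (hb : b s.1 = true) (h : RunsIn p s s' N)
    (h' : RunsIn (.loop b p) s' s'' N') : RunsIn (.loop b p) s s'' (N' + N + 1) := by
  refine ⟨fun {L} M i e hM => ?_⟩
  obtain ⟨n, hn, h⟩ := h.exec M (fun l => i (some l)) (i none) (fun l => hM _)
  obtain ⟨n', hn', h'⟩ := h'.exec M i e hM
  refine ⟨n' + n + 1, by omega, ?_⟩
  rw [Function.iterate_add_apply, Function.iterate_add_apply, ← h']
  congr 1
  rw [show Prog.entry (.loop b p) = none from rfl, ← h]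
  have h0 : M (i none) = _ := hM none
  simp [flip, h0, Prog.code, hb]

end RunsIn

/-- The stacks between two operations: the main stack, the auxiliary stacks, and the counter. -/
def stks (m : List Tok) (T : Tmp → List Tok) (c : List Tok) : ∀ k, List (Alph k)
  | .inp => []
  | .outSymb => []
  | .outBool => []
  | .main => m
  | .tmp t => T t
  | .cnt => c

section Stks

variable (m m' : List Tok) (T : Tmp → List Tok) (c c' : List Tok) (t : Tmp)

@[simp] theorem stks_main : stks m T c .main = m := rfl

@[simp] theorem stks_tmp : stks m T c (.tmp t) = T t := rfl

@[simp] theorem stks_cnt : stks m T c .cnt = c := rfl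

@[simp] theorem update_stks_main :
    Function.update (stks m T c) .main m' = stks m' T c := by
  funext k; cases k <;> rfl

@[simp] theorem update_stks_cnt :
    Function.update (stks m T c) .cnt c' = stks m T c' := by
  funext k; cases k <;> rfl

@[simp] theorem update_stks_tmp :
    Function.update (stks m T c) (.tmp t) m' = stks m (Function.update T t m') c := by
  funext k
  cases k with
  | tmp u => by_cases h : u = t <;> [(subst h; simp [stks]); simp [stks, h]]
  | _ => rfl

end Stks

end StackMachine

/-- The preorder notation of a tree. -/
def DataTree.toks : DataTree → List StackMachine.Tok
  | .atom s => [some s]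
  | .node a b => none :: (a.toks ++ b.toks)

/-- The length of the preorder notation of a tree. -/
def DataTree.size (t : DataTree) : ℕ := t.toks.length

@[simp] theorem DataTree.size_atom (s : Symb) : (DataTree.atom s).size = 1 := rfl

@[simp] theorem DataTree.size_node (a b : DataTree) :
    (DataTree.node a b).size = a.size + b.size + 1 := by
  simp [DataTree.size, DataTree.toks]

theorem DataTree.one_le_size (t : DataTree) : 1 ≤ t.size := by
  cases t <;> simp

/-! ### Stack programs that move, copy and delete trees -/

namespace StackMachine

/-- Pop the main stack into the memory. -/
abbrev popMain : Prog := .pop .main fun _ o => o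

/-- Empty the memory. -/
abbrev clear : Prog := .load fun _ => none

/-- Push the token in the memory. -/
abbrev pushMem : Prog := .push .main fun v => v.getD none

/-- Pop an auxiliary stack into the memory. -/
abbrev popTmp (t : Tmp) : Prog := .pop (.tmp t) fun _ o => o

/-- Push the token in the memory onto an auxiliary stack. -/
abbrev pushTmp (t : Tmp) : Prog := .push (.tmp t) fun v => v.getD none

abbrev popCnt : Prog := .pop .cnt fun _ o => o

abbrev pushCnt : Prog := .push .cnt fun _ => none

/-- The memory holds the token of an inner node. -/
def isNode : Mem → Bool
  | some none => true
  | _ => false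

/-- The memory holds the code of `true`. -/
def isTrue : Mem → Bool
  | some (some (.bit b)) => b
  | _ => false

/-- One step of moving a tree; the counter holds the number of subtrees that are still missing. -/
abbrev takeBody (t : Tmp) : Prog :=
  .seq popMain (.seq (pushTmp t)
    (.seq (.ite (isNode) (.seq pushCnt pushCnt) clear) popCnt))

abbrev takeLoop (t : Tmp) : Prog := .loop Option.isSome (takeBody t)

/-- Move the topmost tree to an auxiliary stack, in reverse. -/
abbrev take (t : Tmp) : Prog := .seq pushCnt (.seq popCnt (takeLoop t))

/-- Continuation form: the hypothesis describes the run after the tree has been moved, so that at a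
node the induction hypotheses for the two subtrees can be chained. The counter holds the subtrees
missing besides the current one: a node adds two and every round removes one. Popping the empty
counter leaves the memory empty, which ends the loop. -/
theorem runsIn_takeLoop (t : Tmp) (d : DataTree) :
    ∀ (R c : List Tok) (T : Tmp → List Tok) (v : Mem) (s : Store) (N : ℕ), v.isSome →
      RunsIn (takeLoop t)
        (c.head?, stks R (Function.update T t (d.toks.reverse ++ T t)) c.tail) s N →
      RunsIn (takeLoop t) (v, stks (d.toks ++ R) T c) s (N + 8 * d.size) := by
  induction d with
  | atom a =>
    intro R c T v s N hv h
    refine (RunsIn.loop_true (N' := N) hv (.seq .pop (.seq .push (.seq (.ite_false ?_ .load) .pop)))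
      ?_).mono ?_
    · rfl
    · simpa [DataTree.toks] using h
    · simp
  | node a b iha ihb =>
    intro R c T v s N hv h
    refine (RunsIn.loop_true (N' := N + 8 * b.size + 8 * a.size) hv
      (.seq .pop (.seq .push (.seq (.ite_true ?_ (.seq .push .push)) .pop))) ?_).mono ?_
    · rfl
    · simp only [DataTree.toks, List.cons_append, stks_main, List.head?_cons, List.tail_cons,
        update_stks_main, update_stks_tmp, update_stks_cnt, stks_cnt, stks_tmp,
        List.append_assoc]
      refine iha _ _ _ _ _ _ rfl ?_
      refine ihb _ _ _ _ _ _ rfl ?_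
      simpa [DataTree.toks] using h
    · simp; omega

theorem runsIn_take (t : Tmp) (d : DataTree) (R : List Tok) (T : Tmp → List Tok) (v : Mem) :
    RunsIn (take t) (v, stks (d.toks ++ R) T [])
      (none, stks R (Function.update T t (d.toks.reverse ++ T t)) []) (8 * d.size + 3) := by
  refine (RunsIn.seq .push (.seq (N' := 1 + 8 * d.size) .pop ?_)).mono ?_
  · simp only [stks_cnt, update_stks_cnt]
    exact runsIn_takeLoop t d _ _ _ _ _ _ rfl (.loop_false rfl)
  · omega

/-- Run `p` on each token of an auxiliary stack. -/
abbrev drain (t : Tmp) (p : Prog) : Prog :=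
  .seq (popTmp t) (.loop Option.isSome (.seq p (popTmp t)))

/-- `F` and `G` describe the effect of the body on the main stack and on the auxiliary stacks. `hG`
and `hG'` say that the body neither reads nor changes the stack being drained, so the fold may start
from the store with that stack already emptied. -/
theorem runsIn_drain {t : Tmp} {p : Prog} {c : ℕ} (F : List Tok → Tok → List Tok)
    (G : (Tmp → List Tok) → Tok → (Tmp → List Tok))
    (hp : ∀ a R T, RunsIn p (some a, stks R T []) (some a, stks (F R a) (G T a) []) c)
    (hG : ∀ T a l, Function.update (G T a) t l = G (Function.update T t l) a)
    (hG' : ∀ T a, G T a t = T t) :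
    ∀ (l R : List Tok) (T : Tmp → List Tok) (v : Mem), T t = l →
      RunsIn (drain t p) (v, stks R T [])
        (none, stks (l.foldl F R) (l.foldl G (Function.update T t [])) [])
          ((c + 2) * l.length + 2) := by
  suffices h : ∀ (l R : List Tok) (T : Tmp → List Tok), T t = l.tail →
      RunsIn (.loop Option.isSome (.seq p (popTmp t))) (l.head?, stks R T [])
        (none, stks (l.foldl F R) (l.foldl G (Function.update T t [])) [])
          ((c + 2) * l.length + 1) by
    intro l R T v hl
    refine (RunsIn.seq (N' := (c + 2) * l.length + 1) .pop ?_).mono ?_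
    · have := h l R (Function.update T t l.tail) (by simp)
      simpa [hl] using this
    · omega
  intro l
  induction l with
  | nil =>
    intro R T hT
    have : Function.update T t [] = T := by
      rw [Function.update_eq_self_iff]; simpa using hT.symm
    simpa [this] using RunsIn.loop_false (p := (Prog.seq p (popTmp t))) rfl
  | cons a l ih =>
    intro R T hT
    refine (RunsIn.loop_true (N' := (c + 2) * l.length + 1) (by rfl) ((hp a R T).seq .pop) ?_).mono ?_
    · have := ih (F R a) (Function.update (G T a) t l.tail) (by simp)
      simp only [stks_tmp, update_stks_tmp, hG', hT, List.tail_cons]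
      simpa [hG] using this
    · simp; ring_nf; omega

/-- Move the contents of an auxiliary stack to the main stack, in reverse. -/
abbrev put (t : Tmp) : Prog := drain t pushMem

theorem runsIn_put (t : Tmp) (R : List Tok) (T : Tmp → List Tok) (v : Mem) :
    RunsIn (put t) (v, stks R T [])
      (none, stks ((T t).reverse ++ R) (Function.update T t []) [])
        (3 * (T t).length + 2) := by
  have := runsIn_drain (t := t) (p := pushMem) (c := 1) (fun R a => a :: R) (fun T _ => T)
    (fun a R T => by
      simpa using RunsIn.push (k := .main) (f := fun v => v.getD none) (v := some a)
        (S := stks R T []))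
    (fun _ _ _ => rfl) (fun _ _ => rfl) (T t) R T v rfl
  have e : ∀ (l R : List Tok), l.foldl (fun R a => a :: R) R = l.reverse ++ R := by
    intro l; induction l <;> simp_all
  have e' : ∀ (l : List Tok) (T : Tmp → List Tok), l.foldl (fun T _ => T) T = T := by
    intro l; induction l <;> simp_all
  simpa [e, e'] using this

/-- The store between two operations: only the main stack is in use. -/
def idle (R : List Tok) : Store := (none, stks R (fun _ => []) [])

/-- Remove the topmost tree. -/
abbrev drop : Prog := .seq (take .x) (drain .x (.load id))

theorem runsIn_drop (d : DataTree) (R : List Tok) :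
    RunsIn drop (idle (d.toks ++ R)) (idle R) (11 * d.size + 5) := by
  have h := runsIn_drain (t := .x) (p := .load id) (c := 1) (fun R _ => R) (fun T _ => T)
    (fun a R T => .load) (fun _ _ _ => rfl) (fun _ _ => rfl) d.toks.reverse R
    (Function.update (fun _ => []) .x d.toks.reverse) none (by simp)
  have e : ∀ (l R : List Tok), l.foldl (fun R _ => R) R = R := by
    intro l; induction l <;> simp_all
  have e' : ∀ (l : List Tok) (T : Tmp → List Tok), l.foldl (fun T _ => T) T = T := by
    intro l; induction l <;> simp_all
  have h' := runsIn_take .x d R (fun _ => []) none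
  simp [e, e'] at h h'
  refine (h'.seq h).mono ?_
  simp only [DataTree.size]
  omega

/-- Exchange the two topmost trees. -/
abbrev swap : Prog := .seq (take .x) (.seq (take .y) (.seq (put .x) (put .y)))

theorem runsIn_swap (d d' : DataTree) (R : List Tok) :
    RunsIn swap (idle (d.toks ++ (d'.toks ++ R))) (idle (d'.toks ++ (d.toks ++ R)))
      (11 * d.size + 11 * d'.size + 10) := by
  have h := (runsIn_take .x d (d'.toks ++ R) (fun _ => []) none).seq
    ((runsIn_take .y d' _ _ _).seq ((runsIn_put .x _ _ _).seq (runsIn_put .y _ _ _)))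
  simp [Function.update_comm (show Tmp.x ≠ Tmp.y by decide)] at h
  refine h.mono ?_
  simp only [DataTree.size]
  omega

/-- Move the second and the third tree from the top in front of each other. -/
abbrev swapBelow : Prog :=
  .seq (take .x) (.seq (take .y) (.seq (take .z) (.seq (put .y) (.seq (put .z) (put .x)))))

theorem runsIn_swapBelow (d d' d'' : DataTree) (R : List Tok) :
    RunsIn swapBelow (idle (d.toks ++ (d'.toks ++ (d''.toks ++ R))))
      (idle (d.toks ++ (d''.toks ++ (d'.toks ++ R))))
      (11 * d.size + 11 * d'.size + 11 * d''.size + 15) := by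
  have h := (runsIn_take .x d (d'.toks ++ (d''.toks ++ R)) (fun _ => []) none).seq
    ((runsIn_take .y d' _ _ _).seq ((runsIn_take .z d'' _ _ _).seq
      ((runsIn_put .y _ _ _).seq ((runsIn_put .z _ _ _).seq (runsIn_put .x _ _ _)))))
  simp [Function.update_comm (show Tmp.x ≠ Tmp.y by decide),
    Function.update_comm (show Tmp.x ≠ Tmp.z by decide),
    Function.update_comm (show Tmp.y ≠ Tmp.z by decide)] at h
  refine h.mono ?_
  simp only [DataTree.size]
  omega

/-- Duplicate the topmost tree. -/
abbrev dup : Prog :=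
  .seq (take .x) (.seq (drain .x (.seq pushMem (pushTmp .y)))
    (.seq (drain .y (pushTmp .z)) (put .z)))

/-- Draining `.x` leaves the tokens on `.y` in reading order, and `put` would reverse them; hence
the detour through `.z`. -/
theorem runsIn_dup (d : DataTree) (R : List Tok) :
    RunsIn dup (idle (d.toks ++ R)) (idle (d.toks ++ (d.toks ++ R))) (18 * d.size + 9) := by
  have e : ∀ (t : Tmp) (l : List Tok) (T : Tmp → List Tok),
      l.foldl (fun T a => Function.update T t (a :: T t)) T =
        Function.update T t (l.reverse ++ T t) := by
    intro t l
    induction l with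
    | nil => simp
    | cons a l ih => intro T; simp [ih]
  have e' : ∀ (l R : List Tok), l.foldl (fun R a => a :: R) R = l.reverse ++ R := by
    intro l; induction l <;> simp_all
  have e'' : ∀ (l R : List Tok), l.foldl (fun R _ => R) R = R := by
    intro l; induction l <;> simp_all
  have h1 := runsIn_take .x d R (fun _ => []) none
  have h2 := runsIn_drain (t := .x) (p := .seq pushMem (pushTmp .y)) (c := 2)
    (fun R a => a :: R) (fun T a => Function.update T .y (a :: T .y))
    (fun a R T => by
      simpa using (RunsIn.push (k := .main) (f := fun v => v.getD none) (v := some a)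
        (S := stks R T [])).seq (RunsIn.push (k := .tmp .y) (f := fun v => v.getD none)))
    (fun T a l => by
      rw [Function.update_comm (by decide), Function.update_of_ne (by decide)])
    (fun T a => by simp) d.toks.reverse R
    (Function.update (fun _ => []) .x d.toks.reverse) none (by simp)
  have h3 := runsIn_drain (t := .y) (p := pushTmp .z) (c := 1)
    (fun R _ => R) (fun T a => Function.update T .z (a :: T .z))
    (fun a R T => by
      simpa using RunsIn.push (k := .tmp .z) (f := fun v => v.getD none) (v := some a)
        (S := stks R T []))
    (fun T a l => by
      rw [Function.update_comm (by decide), Function.update_of_ne (by decide)])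
    (fun T a => by simp) d.toks (d.toks ++ R)
    (Function.update (fun _ => []) .y d.toks) none (by simp)
  have h4 := runsIn_put .z (d.toks ++ R) (Function.update (fun _ => []) .z d.toks.reverse) none
  simp [e, e', e''] at h1 h2 h3 h4
  refine (h1.seq (h2.seq (h3.seq h4))).mono ?_
  simp only [DataTree.size]
  omega

theorem runsIn_popTok (t : Tok) (R : List Tok) :
    RunsIn (.pop .main fun _ _ => none) (idle (t :: R)) (idle R) 1 := by
  simpa [idle] using RunsIn.pop (k := .main) (f := fun _ _ => none) (v := none)
    (S := stks (t :: R) (fun _ => []) [])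

theorem runsIn_pushTok (t : Tok) (v : Mem) (R : List Tok) :
    RunsIn (.push .main fun _ => t) (v, stks R (fun _ => []) [])
      (v, stks (t :: R) (fun _ => []) []) 1 := by
  simpa [idle] using RunsIn.push (k := .main) (f := fun _ => t) (v := v)
    (S := stks R (fun _ => []) [])

theorem runsIn_popMain (t : Tok) (v : Mem) (R : List Tok) :
    RunsIn popMain (v, stks (t :: R) (fun _ => []) []) (some t, stks R (fun _ => []) []) 1 := by
  simpa [idle] using RunsIn.pop (k := .main) (f := fun _ o => o) (v := v)
    (S := stks (t :: R) (fun _ => []) [])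

theorem runsIn_clear (v : Mem) (R : List Tok) :
    RunsIn clear (v, stks R (fun _ => []) []) (idle R) 1 := .load

/-- Push a list of tokens. -/
def pushToks : List Tok → Prog
  | [] => clear
  | t :: l => .seq (pushToks l) (.push .main fun _ => t)

theorem runsIn_pushToks (l R : List Tok) :
    RunsIn (pushToks l) (idle R) (idle (l ++ R)) (l.length + 1) := by
  induction l with
  | nil => exact runsIn_clear _ _
  | cons t l ih => exact (ih.seq (runsIn_pushTok t _ _)).mono (by simp)

end StackMachine

open StackMachine

theorem Polynomial.eval_le_eval_of_le (q : Polynomial ℕ) {a b : ℕ} (h : a ≤ b) :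
    q.eval a ≤ q.eval b := by
  simp only [Polynomial.eval_eq_sum_range]
  gcongr

/-! ### Functions computed on tree codes in polynomial time -/

/-- Types whose elements are represented by trees. -/
class TreeCode (α : Type) where
  code : α → DataTree

namespace TreeCode

/-- The preorder notation of the code. -/
abbrev toks {α : Type} [TreeCode α] (a : α) : List Tok := (code a).toks

/-- The size of the code. -/
def size {α : Type} [TreeCode α] (a : α) : ℕ := (code a).size

instance : TreeCode Symb := ⟨.atom⟩

instance : TreeCode Bool := ⟨fun b => .atom (.bit b)⟩

instance {α β : Type} [TreeCode α] [TreeCode β] : TreeCode (α × β) :=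
  ⟨fun p => .node (code p.1) (code p.2)⟩

/-- The code of a list. -/
def listCode {α : Type} [TreeCode α] : List α → DataTree
  | [] => .atom .sep
  | a :: l => .node (code a) (listCode l)

instance {α : Type} [TreeCode α] : TreeCode (List α) := ⟨listCode⟩

/-- Unary, so arithmetic reduces to list operations. This is affordable only for numbers bounded
polynomially in the input length; costs are bit lists instead. -/
instance : TreeCode ℕ := ⟨fun n => code (List.replicate n Symb.mark)⟩

section size

variable {α β : Type} [TreeCode α] [TreeCode β]

@[simp] theorem size_code (a : α) : (code a).size = size a := rfl

@[simp] theorem length_toks (a : α) : (code a).toks.length = size a := rfl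

@[simp] theorem toks_symb (s : Symb) : toks s = [some s] := rfl

@[simp] theorem toks_bool (b : Bool) : toks b = [some (.bit b)] := rfl

@[simp] theorem toks_prod (p : α × β) : toks p = none :: (toks p.1 ++ toks p.2) := rfl

@[simp] theorem toks_nil : toks ([] : List α) = [some .sep] := rfl

@[simp] theorem toks_cons (a : α) (l : List α) : toks (a :: l) = none :: (toks a ++ toks l) := rfl

theorem one_le_size (a : α) : 1 ≤ size a := DataTree.one_le_size _

@[simp] theorem size_symb (s : Symb) : size s = 1 := rfl

@[simp] theorem size_bool (b : Bool) : size b = 1 := rfl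

@[simp] theorem size_prod (p : α × β) : size p = size p.1 + size p.2 + 1 :=
  DataTree.size_node _ _

@[simp] theorem size_nil : size ([] : List α) = 1 := rfl

@[simp] theorem size_cons (a : α) (l : List α) : size (a :: l) = size a + size l + 1 :=
  DataTree.size_node _ _

@[simp] theorem size_nat (n : ℕ) : size n = 2 * n + 1 := by
  change size (List.replicate n Symb.mark) = _
  induction n with
  | zero => rfl
  | succ n ih => rw [List.replicate_succ, size_cons, ih, size_symb]; ring

theorem size_append (l l' : List α) : size (l ++ l') + 1 = size l + size l' := by
  induction l with
  | nil => simp [add_comm]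
  | cons a l ih => simp; omega

theorem size_eq_sum (l : List α) : size l = (l.map fun a => size a + 1).sum + 1 := by
  induction l with
  | nil => simp
  | cons a l ih => simp [ih]; omega

theorem length_lt_size (l : List α) : l.length < size l := by
  induction l with
  | nil => simp
  | cons a l ih => simp; omega

theorem size_lt_of_mem {a : α} {l : List α} (h : a ∈ l) : size a < size l := by
  induction l with
  | nil => simp at h
  | cons b l ih =>
    rcases List.mem_cons.1 h with rfl | h
    · simp only [size_cons]; omega
    · have := ih h; simp; omega

theorem size_le_of_forall_le {l : List α} {c : ℕ} (h : ∀ a ∈ l, size a ≤ c) :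
    size l ≤ l.length * (c + 1) + 1 := by
  induction l with
  | nil => simp
  | cons a l ih =>
    have h1 := h a (by simp)
    have h2 := ih fun b hb => h b (by simp [hb])
    simp only [size_cons, List.length_cons, add_mul]
    omega

theorem size_le_of_prefix {l l' : List α} (h : l' <+: l) : size l' ≤ size l := by
  obtain ⟨t, rfl⟩ := h
  have := size_append l' t
  have := one_le_size t
  omega

@[simp] theorem size_reverse (l : List α) : size l.reverse = size l := by
  simp [size_eq_sum, List.sum_reverse]

end size

end TreeCode

open TreeCode

variable {α β γ δ : Type} [TreeCode α] [TreeCode β] [TreeCode γ] [TreeCode δ]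

/-- The function `f` is computed by a stack program in time polynomial in the size of the code of
the argument. -/
@[fun_prop]
def PolyTime (f : α → β) : Prop :=
  ∃ (p : Prog) (q : Polynomial ℕ), ∀ a,
    (∀ R, RunsIn p (idle (toks a ++ R)) (idle (toks (f a) ++ R)) (q.eval (size a))) ∧
      size (f a) ≤ q.eval (size a)

/-! ### Composition, pairing and case distinction -/

namespace PolyTime

theorem size_le {f : α → β} (h : PolyTime f) :
    ∃ q : Polynomial ℕ, ∀ a, size (f a) ≤ q.eval (size a) := by
  obtain ⟨p, q, h⟩ := h
  exact ⟨q, fun a => (h a).2⟩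

@[fun_prop]
theorem id : PolyTime fun a : α => a := by
  refine ⟨clear, .X + 1, fun a => ⟨fun R => (runsIn_clear _ _).mono (by simp), by simp⟩⟩

@[fun_prop]
theorem const (b : β) : PolyTime fun _ : α => b := by
  refine ⟨.seq drop (pushToks (toks b)), 11 * .X + 6 + .C (size b), fun a => ⟨fun R => ?_, ?_⟩⟩
  · refine ((runsIn_drop _ R).seq (runsIn_pushToks (toks b) R)).mono ?_
    simp; omega
  · simp

@[fun_prop]
theorem comp {g : β → γ} {f : α → β} (hg : PolyTime g) (hf : PolyTime f) :
    PolyTime fun a => g (f a) := by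
  obtain ⟨p, q, hp⟩ := hf
  obtain ⟨p', q', hp'⟩ := hg
  refine ⟨.seq p p', q + q'.comp q, fun a => ⟨fun R => ?_, ?_⟩⟩
  · refine (((hp a).1 R).seq ((hp' _).1 R)).mono ?_
    simpa using q'.eval_le_eval_of_le (hp a).2
  · have := q'.eval_le_eval_of_le (hp a).2
    have := (hp' (f a)).2
    simp; omega

@[fun_prop]
theorem prodMk {f : α → β} {g : α → γ} (hf : PolyTime f) (hg : PolyTime g) :
    PolyTime fun a => (f a, g a) := by
  obtain ⟨p, q, hp⟩ := hf
  obtain ⟨p', q', hp'⟩ := hg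
  refine ⟨.seq dup (.seq p (.seq swap (.seq p' (.seq swap (.push .main fun _ => none))))),
    29 * .X + 12 * q' + 23 * q + 30, fun a => ⟨fun R => ?_, ?_⟩⟩
  · refine ((runsIn_dup _ _).seq (((hp a).1 _).seq ((runsIn_swap _ _ _).seq
      (((hp' a).1 _).seq ((runsIn_swap _ _ _).seq (runsIn_pushTok none _ _)))))).mono' ?_ ?_
    · simp [idle]
    · have h1 := (hp a).2
      have h2 := (hp' a).2
      simp at *
      omega
  · have h1 := (hp a).2
    have h2 := (hp' a).2
    simp
    omega

/-- Functions that expect the code of `a` on top of the code of `b`, without an inner node. -/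
theorem exists_runsIn_unpair {f : α → β} {g : α → γ} (hf : PolyTime f) (hg : PolyTime g) :
    ∃ (p : Prog) (q : Polynomial ℕ), ∀ a, (∀ R, RunsIn p (idle (toks a ++ R))
      (idle (toks (f a) ++ (toks (g a) ++ R))) (q.eval (size a))) ∧
        size (f a) + size (g a) ≤ q.eval (size a) := by
  obtain ⟨p, q, hp⟩ := hf.prodMk hg
  refine ⟨.seq p (.pop .main fun _ _ => none), q + 1, fun a => ⟨fun R => ?_, ?_⟩⟩
  · refine ((((hp a).1 R).mono' (by simp) le_rfl).seq
      (runsIn_popTok none _)).mono (by simp)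
  · have := (hp a).2
    simp at *
    omega

@[fun_prop]
theorem fst {f : α → β × γ} (hf : PolyTime f) : PolyTime fun a => (f a).1 := by
  refine comp (g := Prod.fst) ?_ hf
  refine ⟨.seq (.pop .main fun _ _ => none) (.seq swap drop), 22 * .X + 30,
    fun a => ⟨fun R => ?_, ?_⟩⟩
  · rw [toks_prod, List.cons_append, List.append_assoc]
    refine ((runsIn_popTok none _).seq ((runsIn_swap _ _ R).seq (runsIn_drop _ _))).mono ?_
    simp; omega
  · simp; omega

@[fun_prop]
theorem snd {f : α → β × γ} (hf : PolyTime f) : PolyTime fun a => (f a).2 := by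
  refine comp (g := Prod.snd) ?_ hf
  refine ⟨.seq (.pop .main fun _ _ => none) drop, 22 * .X + 30, fun a => ⟨fun R => ?_, ?_⟩⟩
  · rw [toks_prod, List.cons_append, List.append_assoc]
    refine ((runsIn_popTok none _).seq (runsIn_drop _ _)).mono ?_
    simp; omega
  · simp; omega

-- A nonempty list and the pair of its head and tail have the same code.
@[fun_prop]
theorem list_cons {f : α → β} {g : α → List β} (hf : PolyTime f) (hg : PolyTime g) :
    PolyTime fun a => f a :: g a :=
  hf.prodMk hg

/-- Functions that rewrite a single atom. -/
theorem of_atom {f : α → β} (u : α → Symb) (g : Symb → Symb) (hu : ∀ a, code a = .atom (u a))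
    (hf : ∀ a, code (f a) = .atom (g (u a))) : PolyTime f := by
  refine ⟨.seq popMain (.seq (.push .main fun v => (v.getD none).map g) clear), 3,
    fun a => ⟨fun R => ?_, ?_⟩⟩
  · rw [toks, hu, toks, hf]
    have h := RunsIn.push (k := .main) (f := fun v => (v.getD none).map g) (v := some (some (u a)))
      (S := stks R (fun _ => []) [])
    simp only [update_stks_main] at h
    exact ((runsIn_popMain (some (u a)) none R).seq (h.seq (runsIn_clear _ _))).mono (by simp)
  · change (code (f a)).size ≤ _
    simp [hf]

theorem symb_bool (g : Symb → Bool) {f : α → Symb} (hf : PolyTime f) : PolyTime fun a => g (f a) :=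
  comp (g := g) (of_atom (fun s => s) (fun s => .bit (g s)) (fun _ => rfl) fun _ => rfl) hf

-- Both functions have the same code by definition.
@[fun_prop]
theorem replicate_mark {f : α → ℕ} (hf : PolyTime f) :
    PolyTime fun a => List.replicate (f a) Symb.mark :=
  hf

@[fun_prop]
theorem bool_cond {c : α → Bool} {f g : α → β} (hc : PolyTime c) (hf : PolyTime f)
    (hg : PolyTime g) : PolyTime fun a => bif c a then f a else g a := by
  obtain ⟨p, q, hp⟩ := exists_runsIn_unpair hc id
  obtain ⟨pf, qf, hpf⟩ := hf
  obtain ⟨pg, qg, hpg⟩ := hg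
  refine ⟨.seq p (.seq popMain (.ite isTrue (.seq clear pf) (.seq clear pg))),
    q + qf + qg + 4, fun a => ⟨fun R => ?_, ?_⟩⟩
  · refine (((hp a).1 R).seq ((runsIn_popMain _ _ _).seq
      (N' := qf.eval (size a) + qg.eval (size a) + 2) ?_)).mono ?_
    · beta_reduce
      cases hca : c a
      · exact RunsIn.mono (RunsIn.ite_false rfl ((runsIn_clear _ _).seq ((hpg a).1 R))) (by omega)
      · exact RunsIn.mono (RunsIn.ite_true rfl ((runsIn_clear _ _).seq ((hpf a).1 R))) (by omega)
    · simp; omega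
  · have := (hpf a).2
    have := (hpg a).2
    beta_reduce
    cases hca : c a <;> simp <;> omega

end PolyTime

/-- Case distinction on a list. -/
def List.split {β γ : Type*} (l : List β) (n : γ) (c : β → List β → γ) : γ :=
  match l with
  | [] => n
  | b :: l => c b l

namespace PolyTime

theorem list_split {l : α → List β} {n : α → γ} {c : α → β → List β → γ} (hl : PolyTime l)
    (hn : PolyTime n) (hc : PolyTime fun p : (β × List β) × α => c p.2 p.1.1 p.1.2) :
    PolyTime fun a => (l a).split (n a) (c a) := by
  obtain ⟨p, q, hp⟩ := exists_runsIn_unpair hl id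
  obtain ⟨pf, qf, hpf⟩ := hn
  obtain ⟨pg, qg, hpg⟩ := hc
  -- Once the node token of the list is popped, head, tail and argument lie on the stack; two node
  -- tokens in front turn them into the code of `((b, l'), a)`.
  refine ⟨.seq p (.seq popMain (.ite isNode
    (.seq clear (.seq (pushToks [none, none]) pg)) (.seq clear pf))),
    q + qf + qg.comp (q + 1) + 8, fun a => ⟨fun R => ?_, ?_⟩⟩
  · refine (((hp a).1 R).seq (N' := 1 + (qf.eval (size a) + qg.eval (q.eval (size a) + 1) + 7))
      ?_).mono ?_
    · beta_reduce
      cases hla : l a with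
      | nil =>
        exact RunsIn.mono (RunsIn.seq (runsIn_popMain _ _ _) (RunsIn.ite_false rfl
          ((runsIn_clear _ _).seq ((hpf a).1 R)))) (by omega)
      | cons b l' =>
        have h := (hpg ((b, l'), a)).1 R
        simp only [toks_prod, List.cons_append, List.append_assoc] at h
        simp only [toks_cons, List.cons_append, List.append_assoc, List.split]
        have h2 := (hp a).2
        have h3 : qg.eval (size ((b, l'), a)) ≤ qg.eval (q.eval (size a) + 1) := by
          apply qg.eval_le_eval_of_le
          simp [hla] at h2 ⊢
          omega
        exact RunsIn.mono (RunsIn.seq (runsIn_popMain _ _ _) (RunsIn.ite_true rfl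
          ((runsIn_clear _ _).seq ((runsIn_pushToks [none, none] _).seq h)))) (by simp at h3 ⊢; omega)
    · simp; omega
  · beta_reduce
    cases hla : l a with
    | nil =>
      have := (hpf a).2
      simp [List.split]
      omega
    | cons b l' =>
      have h2 := (hp a).2
      have h3 : qg.eval (size ((b, l'), a)) ≤ qg.eval (q.eval (size a) + 1) := by
        apply qg.eval_le_eval_of_le
        simp [hla] at h2 ⊢
        omega
      have := (hpg ((b, l'), a)).2
      simp [List.split] at *
      omega

end PolyTime

/-! ### Left folds -/

namespace StackMachine

/-- One step of a left fold, with the head and the tail of the list and the accumulated value on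
top of the main stack. -/
abbrev foldBody (p : Prog) : Prog :=
  .seq clear (.seq swapBelow (.seq (.push .main fun _ => none) (.seq p (.seq swap popMain))))

/-- Loop invariant: the memory holds the first token of the remaining list, and the rest of that
list lies above the accumulated value. That token decides whether to go on: `none` for a nonempty
list, the separator for the empty one. `B` bounds the list and all intermediate values, so a single
bound serves every round. -/
theorem runsIn_foldLoop {p : Prog} {q : Polynomial ℕ} {step : γ → β → γ}
    (hp : ∀ b c R, RunsIn p (idle (toks (b, c) ++ R)) (idle (toks (step c b) ++ R))
      (q.eval (size (b, c)))) (B : ℕ) (R : List Tok) :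
    ∀ (l : List β) (c : γ), size l ≤ B → (∀ l', l' <+: l → size (l'.foldl step c) ≤ B) →
      RunsIn (.loop isNode (foldBody p))
        ((toks l).head?, stks ((toks l).tail ++ (toks c ++ R)) (fun _ => []) [])
        (some (some .sep), stks (toks (l.foldl step c) ++ R) (fun _ => []) [])
        (l.length * (q.eval (2 * B) + 55 * B + 30) + 1) := by
  intro l
  induction l with
  | nil =>
    intro c _ _
    exact (RunsIn.loop_false (by rfl)).mono (by omega)
  | cons b l ih =>
    intro c hl hB
    have hc := hB [] (List.nil_prefix)
    have hc' := hB [b] (by simp)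
    have ih' := ih (step c b) (by simp at hl; omega) fun l' h =>
      hB (b :: l') (by simpa using h)
    obtain ⟨t, ts, ht⟩ : ∃ t ts, toks l = t :: ts := by cases l <;> simp
    have h2 := (hp b c (toks l ++ R)).mono (N' := q.eval (2 * B))
      (q.eval_le_eval_of_le (by simp at hl hc ⊢; omega))
    simp only [toks_prod, List.cons_append, List.append_assoc] at h2
    have h3 := runsIn_popMain t none (ts ++ (toks (step c b) ++ R))
    rw [← List.cons_append, ← ht] at h3
    have h1 := (runsIn_clear (some none) (toks b ++ (toks l ++ (toks c ++ R)))).seq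
      ((runsIn_swapBelow (code b) (code l) (code c) R).seq
        ((runsIn_pushTok none _ _).seq (h2.seq
          ((runsIn_swap (code (step c b)) (code l) R).seq h3))))
    have h4 := RunsIn.loop_true (b := isNode) rfl h1
      (by
        rw [ht] at ih'
        exact ih')
    simp only [toks_cons, List.head?_cons, List.tail_cons, List.append_assoc, List.foldl_cons]
    refine h4.mono ?_
    simp [add_mul] at hl hc hc' ⊢
    omega

end StackMachine

namespace PolyTime

/-- The intermediate values are exactly the folds over prefixes. Bounding them is essential:
iterating a polynomial-time step may otherwise produce values of exponential size. -/
theorem list_foldl_of_prefix_le {l : α → List β} {i : α → γ} {step : γ → β → γ}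
    (hl : PolyTime l) (hi : PolyTime i) (hs : PolyTime fun p : β × γ => step p.2 p.1)
    (B : Polynomial ℕ) (hB : ∀ a, ∀ l', l' <+: l a → size (l'.foldl step (i a)) ≤ B.eval (size a)) :
    PolyTime fun a => (l a).foldl step (i a) := by
  obtain ⟨p, q, hp⟩ := exists_runsIn_unpair hl hi
  obtain ⟨pf, qf, hpf⟩ := hs
  refine ⟨.seq p (.seq popMain (.seq (.loop isNode (foldBody pf)) clear)),
    q + q * (qf.comp (2 * (B + q)) + 55 * (B + q) + 30) + 3 + B, fun a => ⟨fun R => ?_, ?_⟩⟩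
  · obtain ⟨t, ts, ht⟩ : ∃ t ts, toks (l a) = t :: ts := by cases l a <;> simp
    have h2 := (hp a).2
    have h := runsIn_foldLoop (fun b c R => (hpf (b, c)).1 R) (B.eval (size a) + q.eval (size a)) R
      (l a) (i a) (by omega) (fun l' hl' => (hB a l' hl').trans (by omega))
    have h1 := (hp a).1 R
    rw [ht] at h h1
    refine (h1.seq ((runsIn_popMain _ _ _).seq (h.seq (runsIn_clear _ _)))).mono ?_
    have h3 : (l a).length ≤ q.eval (size a) := by
      have := length_lt_size (l a)
      omega
    have h4 := Nat.mul_le_mul_right (qf.eval (2 * (B.eval (size a) + q.eval (size a))) +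
      55 * (B.eval (size a) + q.eval (size a)) + 30) h3
    simp
    omega
  · have := hB a _ List.prefix_rfl
    simp
    omega

/-- Left folds whose accumulated values have polynomial size. -/
theorem list_foldl {l : α → List β} {i : α → γ} {step : α → γ → β → γ}
    (hl : PolyTime l) (hi : PolyTime i) (hs : PolyTime fun p : (α × γ) × β => step p.1.1 p.1.2 p.2)
    (B : Polynomial ℕ)
    (hB : ∀ a, ∀ l', l' <+: l a → size (l'.foldl (step a) (i a)) ≤ B.eval (size a)) :
    PolyTime fun a => (l a).foldl (step a) (i a) := by
  -- The step may use the parameter `a`, so `a` is carried along in the accumulator.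
  have key : ∀ a (l : List β) c, l.foldl (fun (s : α × γ) b => (s.1, step s.1 s.2 b)) (a, c) =
      (a, l.foldl (step a) c) := by
    intro a l
    induction l with
    | nil => simp
    | cons b l ih => intro c; simp [ih]
  have h := snd (list_foldl_of_prefix_le (i := fun a => (a, i a))
    (step := fun (s : α × γ) b => (s.1, step s.1 s.2 b)) hl (by fun_prop)
    (prodMk (by fun_prop) (comp hs (f := fun p : β × α × γ => (p.2, p.1)) (by fun_prop)))
    (B + .X + 1) (fun a l' hl' => by
      have := hB a l' hl'
      rw [key]
      simp
      omega))
  simpa only [key] using h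

/-- Left folds that increase the size of the accumulated value by a bounded amount. -/
theorem list_foldl_of_le_add {l : α → List β} {i : α → γ} {step : α → γ → β → γ}
    (hl : PolyTime l) (hi : PolyTime i) (hs : PolyTime fun p : (α × γ) × β => step p.1.1 p.1.2 p.2)
    (G : Polynomial ℕ) (hG : ∀ a c b, size (step a c b) ≤ size c + G.eval (size a + size b)) :
    PolyTime fun a => (l a).foldl (step a) (i a) := by
  obtain ⟨ql, hql⟩ := hl.size_le
  obtain ⟨qi, hqi⟩ := hi.size_le
  refine list_foldl hl hi hs (qi + ql * G.comp (.X + ql)) fun a l' hl' => ?_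
  have h1 := size_le_of_prefix hl'
  have key : ∀ (l' : List β) c, (∀ b ∈ l', size b ≤ size (l a)) → size (l'.foldl (step a) c) ≤
      size c + l'.length * G.eval (size a + size (l a)) := by
    intro l'
    induction l' with
    | nil => simp
    | cons b l' ih =>
      intro c h
      have h2 := ih (step a c b) fun b' hb' => h b' (by simp [hb'])
      have h3 := hG a c b
      have h4 := G.eval_le_eval_of_le (Nat.add_le_add_left (h b (by simp)) (size a))
      simp [add_mul]
      omega
  refine (key l' (i a) fun b hb => (size_lt_of_mem hb).le.trans h1).trans ?_
  simp only [Polynomial.eval_add, Polynomial.eval_mul, Polynomial.eval_comp, Polynomial.eval_X]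
  refine add_le_add (hqi a) (Nat.mul_le_mul ?_ (G.eval_le_eval_of_le ?_))
  · have := length_lt_size l'
    have := hql a
    omega
  · have := hql a
    omega

/-! ### Lists, Booleans and unary arithmetic -/

@[fun_prop]
theorem list_headD {l : α → List β} {d : α → β} (hl : PolyTime l) (hd : PolyTime d) :
    PolyTime fun a => (l a).headD (d a) := by
  have h := list_split (c := fun _ b _ => b) hl hd (by fun_prop)
  convert h using 2 with a
  cases l a <;> rfl

@[fun_prop]
theorem list_tail {l : α → List β} (hl : PolyTime l) : PolyTime fun a => (l a).tail := by
  have h := list_split (n := fun _ => []) (c := fun _ _ l => l) hl (by fun_prop) (by fun_prop)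
  convert h using 2 with a
  cases l a <;> rfl

@[fun_prop]
theorem list_isEmpty {l : α → List β} (hl : PolyTime l) : PolyTime fun a => (l a).isEmpty := by
  have h := list_split (n := fun _ => true) (c := fun _ _ _ => false) hl (by fun_prop)
    (by fun_prop)
  convert h using 2 with a
  cases l a <;> rfl

@[fun_prop]
theorem bool_and {f g : α → Bool} (hf : PolyTime f) (hg : PolyTime g) :
    PolyTime fun a => f a && g a := by
  have h := bool_cond (g := fun _ => false) hf hg (by fun_prop)
  convert h using 2 with a
  cases f a <;> rfl

@[fun_prop]
theorem bool_or {f g : α → Bool} (hf : PolyTime f) (hg : PolyTime g) :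
    PolyTime fun a => f a || g a := by
  have h := bool_cond (f := fun _ => true) hf (by fun_prop) hg
  convert h using 2 with a
  cases f a <;> rfl

@[fun_prop]
theorem bool_not {f : α → Bool} (hf : PolyTime f) : PolyTime fun a => !f a := by
  have h := bool_cond (f := fun _ => false) (g := fun _ => true) hf (by fun_prop) (by fun_prop)
  convert h using 2 with a
  cases f a <;> rfl

@[fun_prop]
theorem bool_xor {f g : α → Bool} (hf : PolyTime f) (hg : PolyTime g) :
    PolyTime fun a => (f a).xor (g a) := by
  have h := bool_cond (f := fun a => !g a) (g := g) hf (by fun_prop) (by fun_prop)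
  convert h using 2 with a
  cases f a <;> simp

@[fun_prop]
theorem list_reverse {l : α → List β} (hl : PolyTime l) : PolyTime fun a => (l a).reverse := by
  have h := list_foldl_of_le_add (i := fun _ => []) (step := fun _ acc b => b :: acc) hl
    (by fun_prop) (by fun_prop) (.X + 1) (fun a c b => by simp; omega)
  have key : ∀ l acc : List β, l.foldl (fun acc b => b :: acc) acc = l.reverse ++ acc := by
    intro l; induction l <;> simp_all
  simpa only [key, List.append_nil] using h

@[fun_prop]
theorem list_append {l l' : α → List β} (hl : PolyTime l) (hl' : PolyTime l') :
    PolyTime fun a => l a ++ l' a := by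
  have h := list_foldl_of_le_add (l := fun a => (l a).reverse) (i := l')
    (step := fun _ acc b => b :: acc) (by fun_prop)
    (by fun_prop) (by fun_prop) (.X + 1) (fun a c b => by simp; omega)
  have key : ∀ l acc : List β, l.foldl (fun acc b => b :: acc) acc = l.reverse ++ acc := by
    intro l; induction l <;> simp_all
  simpa only [key, List.reverse_reverse] using h

@[fun_prop]
theorem list_flatMap {l : α → List β} {g : α → β → List γ} (hl : PolyTime l)
    (hg : PolyTime fun p : α × β => g p.1 p.2) : PolyTime fun a => (l a).flatMap (g a) := by
  obtain ⟨q, hq⟩ := hg.size_le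
  have h := list_foldl_of_le_add (i := fun _ => []) (step := fun a acc b => acc ++ g a b) hl
    (by fun_prop) (by
      have : PolyTime fun p : (α × List γ) × β => g p.1.1 p.2 :=
        hg.comp (f := fun p : (α × List γ) × β => (p.1.1, p.2)) (by fun_prop)
      fun_prop) (q.comp (.X + 1)) (fun a c b => by
      have := size_append c (g a b)
      have := hq (a, b)
      simp at *
      omega)
  have key : ∀ a (l : List β) acc, l.foldl (fun acc b => acc ++ g a b) acc =
      acc ++ l.flatMap (g a) := by
    intro a l; induction l <;> simp_all
  simpa only [key, List.nil_append] using h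

@[fun_prop]
theorem list_map {l : α → List β} {g : α → β → γ} (hl : PolyTime l)
    (hg : PolyTime fun p : α × β => g p.1 p.2) : PolyTime fun a => (l a).map (g a) := by
  have h := list_flatMap (g := fun a b => [g a b]) hl (by fun_prop)
  convert h using 2 with a
  exact List.map_eq_flatMap

@[fun_prop]
theorem list_filter {l : α → List β} {g : α → β → Bool} (hl : PolyTime l)
    (hg : PolyTime fun p : α × β => g p.1 p.2) : PolyTime fun a => (l a).filter (g a) := by
  have h := list_flatMap (g := fun a b => bif g a b then [b] else []) hl (by fun_prop)
  convert h using 2 with a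
  induction l a with
  | nil => rfl
  | cons b l ih => cases hb : g a b <;> simp [hb, ih]

@[fun_prop]
theorem list_any {l : α → List β} {g : α → β → Bool} (hl : PolyTime l)
    (hg : PolyTime fun p : α × β => g p.1 p.2) : PolyTime fun a => (l a).any (g a) := by
  have h := bool_not (list_isEmpty (list_filter hl hg))
  convert h using 2 with a
  induction l a with
  | nil => rfl
  | cons b l ih => cases hb : g a b <;> simp [hb, ih]

@[fun_prop]
theorem nat_succ {f : α → ℕ} (hf : PolyTime f) : PolyTime fun a => f a + 1 :=
  list_cons (const Symb.mark) hf

@[fun_prop]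
theorem list_length {l : α → List β} (hl : PolyTime l) : PolyTime fun a => (l a).length := by
  have h := list_foldl_of_le_add (i := fun _ => 0) (step := fun _ n _ => n + 1) hl
    (by fun_prop) (by fun_prop) 2 (fun a c b => by simp; omega)
  have key : ∀ (l : List β) n, l.foldl (fun n _ => n + 1) n = n + l.length := by
    intro l
    induction l with
    | nil => simp
    | cons b l ih => intro n; simp [ih]; omega
  simpa only [key, zero_add] using h

@[fun_prop]
theorem nat_add {f g : α → ℕ} (hf : PolyTime f) (hg : PolyTime g) :
    PolyTime fun a => f a + g a := by
  have h : PolyTime fun a =>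
      (List.replicate (f a) Symb.mark ++ List.replicate (g a) Symb.mark).length := by fun_prop
  simpa using h

@[fun_prop]
theorem list_drop {l : α → List β} {f : α → ℕ} (hl : PolyTime l) (hf : PolyTime f) :
    PolyTime fun a => (l a).drop (f a) := by
  have h := list_foldl_of_le_add (l := fun a => List.replicate (f a) Symb.mark) (i := l)
    (step := fun _ l _ => l.tail) (by fun_prop) hl (by fun_prop) 0 (fun a c b => by
      cases c <;> simp; omega)
  have key : ∀ n (l : List β), (List.replicate n Symb.mark).foldl (fun l _ => l.tail) l =
      l.drop n := by
    intro n
    induction n with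
    | zero => simp
    | succ n ih => intro l; simp [List.replicate_succ, ih]
  simpa only [key] using h

@[fun_prop]
theorem nat_sub {f g : α → ℕ} (hf : PolyTime f) (hg : PolyTime g) :
    PolyTime fun a => f a - g a := by
  have h : PolyTime fun a => ((List.replicate (f a) Symb.mark).drop (g a)).length := by fun_prop
  simpa using h

@[fun_prop]
theorem nat_le {f g : α → ℕ} (hf : PolyTime f) (hg : PolyTime g) :
    PolyTime fun a => decide (f a ≤ g a) := by
  have h : PolyTime fun a => (List.replicate (f a - g a) Symb.mark).isEmpty := by fun_prop
  convert h using 2 with a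
  rw [Bool.eq_iff_iff]
  simp [Nat.sub_eq_zero_iff_le]

@[fun_prop]
theorem nat_lt {f g : α → ℕ} (hf : PolyTime f) (hg : PolyTime g) :
    PolyTime fun a => decide (f a < g a) :=
  nat_le (nat_succ hf) hg

@[fun_prop]
theorem nat_eq {f g : α → ℕ} (hf : PolyTime f) (hg : PolyTime g) :
    PolyTime fun a => decide (f a = g a) := by
  have h : PolyTime fun a => decide (f a ≤ g a) && decide (g a ≤ f a) := by fun_prop
  convert h using 2 with a
  rw [Bool.eq_iff_iff]
  simp [le_antisymm_iff]

@[fun_prop]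
theorem list_range {f : α → ℕ} (hf : PolyTime f) : PolyTime fun a => List.range (f a) := by
  refine comp (g := List.range) ?_ hf
  have key : ∀ n, (List.replicate n Symb.mark).foldl (fun (l : List ℕ) _ => l ++ [l.length]) [] =
      List.range n := by
    intro n
    induction n with
    | zero => rfl
    | succ n ih => rw [List.replicate_succ', List.foldl_append, ih]; simp [List.range_succ]
  -- The appended length grows with the accumulator, so `list_foldl_of_le_add` does not apply. The
  -- prefixes are bounded directly: they give `List.range k` with `k ≤ n`.
  have h := list_foldl (l := fun n => List.replicate n Symb.mark) (i := fun _ : ℕ => ([] : List ℕ))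
    (step := fun _ l _ => l ++ [l.length]) (by fun_prop) (by fun_prop) (by fun_prop)
    (.X * (2 * .X + 2) + 1) (fun n l' hl' => by
      obtain ⟨k, hk, rfl⟩ : ∃ k ≤ n, l' = List.replicate k Symb.mark :=
        ⟨l'.length, by simpa using hl'.length_le, by
          obtain ⟨t, ht⟩ := hl'
          exact (List.append_eq_replicate_iff.1 ht).2.1⟩
      rw [key]
      refine (size_le_of_forall_le (c := 2 * n + 1) fun a ha => ?_).trans ?_
      · have := List.mem_range.1 ha
        simp; omega
      · have := Nat.mul_le_mul_right (2 * n + 1 + 1) hk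
        simp
        nlinarith)
  simpa only [key] using h

end PolyTime

/-! ### Turing machines for functions on lists of symbols -/

open scoped Classical in
noncomputable instance : Fintype Symb :=
  Fintype.ofSurjective
    (fun o : Bool ⊕ Fin 5 => match o with
      | .inl b => Symb.bit b
      | .inr 0 => .mark
      | .inr 1 => .infinity
      | .inr 2 => .minus
      | .inr 3 => .sep
      | .inr 4 => .noAnswer)
    (by
      rintro (b | _ | _ | _ | _ | _)
      exacts [⟨.inl b, rfl⟩, ⟨.inr 0, rfl⟩, ⟨.inr 1, rfl⟩, ⟨.inr 2, rfl⟩, ⟨.inr 3, rfl⟩,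
        ⟨.inr 4, rfl⟩])

namespace StackMachine

/-- The Turing machine that executes a program and halts. -/
noncomputable def machine (p : Prog) (out : Stk) : FinTM2 :=
  letI := p.fintypeLab
  { K := Stk
    k₀ := .inp
    k₁ := out
    Γ := Alph
    Λ := Option p.Lab
    main := some p.entry
    σ := Mem
    initialState := none
    Γk₀Fin := inferInstanceAs (Fintype Symb)
    m := fun l => match l with
      | none => .halt
      | some l => p.code some none l }

/-- Stacks during input and output. -/
def ioStks (w : List Symb) (m : List Tok) (u : List Symb) (b : List Bool) : ∀ k, List (Alph k)
  | .inp => w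
  | .outSymb => u
  | .outBool => b
  | .main => m
  | .tmp _ => []
  | .cnt => []

section ioStks

variable (w : List Symb) (m : List Tok) (u : List Symb) (b : List Bool)

@[simp] theorem ioStks_inp : ioStks w m u b .inp = w := rfl
@[simp] theorem ioStks_outSymb : ioStks w m u b .outSymb = u := rfl
@[simp] theorem ioStks_outBool : ioStks w m u b .outBool = b := rfl
@[simp] theorem ioStks_main : ioStks w m u b .main = m := rfl

@[simp] theorem update_ioStks_inp (w' : List Symb) :
    Function.update (ioStks w m u b) .inp w' = ioStks w' m u b := by
  funext k; cases k <;> rfl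

@[simp] theorem update_ioStks_main (m' : List Tok) :
    Function.update (ioStks w m u b) .main m' = ioStks w m' u b := by
  funext k; cases k <;> rfl

@[simp] theorem update_ioStks_outSymb (u' : List Symb) :
    Function.update (ioStks w m u b) .outSymb u' = ioStks w m u' b := by
  funext k; cases k <;> rfl

@[simp] theorem update_ioStks_outBool (b' : List Bool) :
    Function.update (ioStks w m u b) .outBool b' = ioStks w m u b' := by
  funext k; cases k <;> rfl

theorem ioStks_eq_stks : ioStks [] m [] [] = stks m (fun _ => []) [] := by
  funext k; cases k <;> rfl

end ioStks

/-- The exit label `none` carries the statement `halt`, which takes the one additional step. -/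
theorem exists_iterate_machine {p : Prog} {out : Stk} {S S' : ∀ k, List (Alph k)} {N : ℕ}
    (h : RunsIn p (none, S) (none, S') N) :
    ∃ n ≤ N + 1, (flip bind (machine p out).step)^[n]
      (some ⟨some (some p.entry), none, S⟩) = some ⟨none, none, S'⟩ := by
  obtain ⟨n, hn, h⟩ := h.exec (machine p out).m some none (fun _ => rfl)
  refine ⟨n + 1, by omega, ?_⟩
  rw [Function.iterate_succ_apply']
  exact congrArg (flip bind (machine p out).step) h

theorem outputs_symb {p : Prog} {w u : List Symb} {N B : ℕ}
    (h : RunsIn p (none, ioStks w [] [] []) (none, ioStks [] [] u []) N) (hN : N + 1 ≤ B) :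
    Nonempty (TM2OutputsInTime (machine p .outSymb) w (some u) B) := by
  obtain ⟨n, hn, h⟩ := exists_iterate_machine (out := .outSymb) h
  refine ⟨⟨⟨n, ?_⟩, hn.trans hN⟩⟩
  have h1 : initList (machine p .outSymb) w = ⟨some (some p.entry), none, ioStks w [] [] []⟩ := by
    unfold initList
    congr 1
    funext k; cases k <;> rfl
  have h2 : haltList (machine p .outSymb) u = ⟨none, none, ioStks [] [] u []⟩ := by
    unfold haltList
    congr 1
    funext k; cases k <;> rfl
  rw [h1]
  exact h.trans (congrArg some h2.symm)

theorem outputs_bool {p : Prog} {w : List Symb} {b : List Bool} {N B : ℕ}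
    (h : RunsIn p (none, ioStks w [] [] []) (none, ioStks [] [] [] b) N) (hN : N + 1 ≤ B) :
    Nonempty (TM2OutputsInTime (machine p .outBool) w (some b) B) := by
  obtain ⟨n, hn, h⟩ := exists_iterate_machine (out := .outBool) h
  refine ⟨⟨⟨n, ?_⟩, hn.trans hN⟩⟩
  have h1 : initList (machine p .outBool) w = ⟨some (some p.entry), none, ioStks w [] [] []⟩ := by
    unfold initList
    congr 1
    funext k; cases k <;> rfl
  have h2 : haltList (machine p .outBool) b = ⟨none, none, ioStks [] [] [] b⟩ := by
    unfold haltList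
    congr 1
    funext k; cases k <;> rfl
  rw [h1]
  exact h.trans (congrArg some h2.symm)

abbrev popInp : Prog := .pop .inp fun _ o => o.map some

/-- Read the input onto the main stack, as the code of a list in reverse. -/
abbrev readInput : Prog :=
  .seq (.push .main fun _ => some .sep) (.seq popInp
    (.loop Option.isSome (.seq pushMem (.seq (.push .main fun _ => none) popInp))))

theorem runsIn_readInput (w : List Symb) :
    RunsIn readInput (none, ioStks w [] [] []) (idle (toks w.reverse)) (4 * w.length + 3) := by
  have key : ∀ w u : List Symb, RunsIn
      (.loop Option.isSome (.seq pushMem (.seq (.push .main fun _ => none) popInp)))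
      (w.head?.map some, ioStks w.tail (toks u) [] [])
      (none, ioStks [] (toks (w.reverse ++ u)) [] []) (4 * w.length + 1) := by
    intro w
    induction w with
    | nil => intro u; exact (RunsIn.loop_false (by rfl)).mono (by omega)
    | cons s w ih =>
      intro u
      have h := RunsIn.loop_true (b := Option.isSome)
        (s := ((some (some s) : Mem), ioStks w (toks u) [] [])) rfl
        ((RunsIn.push (k := .main) (f := fun v => v.getD none)).seq
          ((RunsIn.push (k := .main) (f := fun _ => none)).seq
            (RunsIn.pop (k := .inp) (f := fun _ o => o.map some))))
        (by simpa using ih (s :: u))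
      simp only [List.reverse_cons, List.append_assoc, List.singleton_append]
      exact h.mono (by simp; omega)
  have h := (RunsIn.push (k := .main) (f := fun _ => some .sep) (v := none)
    (S := ioStks w [] [] [])).seq ((RunsIn.pop (k := .inp) (f := fun _ o => o.map some)).seq
      (by simpa using key w []))
  simp only [ioStks_eq_stks] at h
  exact h.mono (by omega)

/-- Write a list of symbols in reverse. -/
abbrev writeSymb : Prog :=
  .seq popMain (.seq (.loop isNode (.seq popMain (.seq
    (.push .outSymb fun v => (v.getD none).getD .sep) popMain))) clear)

theorem runsIn_writeSymb (l : List Symb) :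
    RunsIn writeSymb (idle (toks l)) (none, ioStks [] [] l.reverse []) (4 * l.length + 3) := by
  have key : ∀ l u : List Symb, RunsIn
      (.loop isNode (.seq popMain (.seq
        (.push .outSymb fun v => (v.getD none).getD .sep) popMain)))
      ((toks l).head?, ioStks [] (toks l).tail u [])
      (some (some .sep), ioStks [] [] (l.reverse ++ u) []) (4 * l.length + 1) := by
    intro l
    induction l with
    | nil => intro u; exact (RunsIn.loop_false (by rfl)).mono (by omega)
    | cons s l ih =>
      intro u
      have h := RunsIn.loop_true (b := isNode)
        (s := ((some none : Mem), ioStks [] (some s :: toks l) u [])) rfl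
        ((RunsIn.pop (k := .main) (f := fun _ o => o)).seq
          ((RunsIn.push (k := .outSymb) (f := fun v => (v.getD none).getD .sep)).seq
            (RunsIn.pop (k := .main) (f := fun _ o => o))))
        (by simpa using ih (s :: u))
      simp only [List.reverse_cons, List.append_assoc, List.singleton_append]
      exact h.mono (by simp; omega)
  have h := (RunsIn.pop (k := .main) (f := fun _ o => o) (v := none)
    (S := ioStks [] (toks l) [] [])).seq (RunsIn.seq (by simpa using key l [])
      (RunsIn.load (f := fun _ => none)))
  simp only [ioStks_eq_stks] at h
  exact h.mono (by omega)

/-- Write a Boolean. -/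
abbrev writeBool : Prog :=
  .seq popMain (.seq (.push .outBool isTrue) clear)

theorem runsIn_writeBool (b : Bool) :
    RunsIn writeBool (idle (toks b)) (none, ioStks [] [] [] [b]) 3 := by
  rw [idle, ← ioStks_eq_stks]
  have h := (RunsIn.pop (k := .main) (f := fun _ o => o) (v := none)
    (S := ioStks [] (toks b) [] [])).seq ((RunsIn.push (k := .outBool) (f := isTrue)).seq
      (RunsIn.load (f := fun _ => none)))
  simpa [isTrue] using h

end StackMachine

theorem TreeCode.size_symbs (w : List Symb) : size w = 2 * w.length + 1 := by
  induction w with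
  | nil => rfl
  | cons s w ih => simp [ih]; ring

namespace PolyTime

theorem tm2ComputableInPolyTime_symb {α β : Type} {enc : α → List Symb} {enc' : β → List Symb}
    {F : α → β} {g : List Symb → List Symb} (hg : PolyTime g) (h : ∀ a, g (enc a) = enc' (F a)) :
    Nonempty (TM2ComputableInPolyTime enc enc' F) := by
  -- Reading and writing each reverse the word; conjugating by `list_reverse` undoes both.
  obtain ⟨p, q, hp⟩ := list_reverse (comp hg (list_reverse PolyTime.id))
  refine ⟨{
    tm := machine (.seq readInput (.seq p writeSymb)) .outSymb
    inputAlphabet := Equiv.refl _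
    outputAlphabet := Equiv.refl _
    time := 4 * .X + 3 * q.comp (2 * .X + 1) + 7
    outputsFun := fun a => Classical.choice ?_ }⟩
  have h1 := ((hp (enc a).reverse).1 [])
  have h2 := ((hp (enc a).reverse).2)
  simp only [List.reverse_reverse, List.append_nil, h] at h1 h2
  have h3 := (runsIn_readInput (enc a)).seq (h1.seq (runsIn_writeSymb _))
  rw [List.reverse_reverse] at h3
  have h4 : 2 * (enc' (F a)).length + 1 ≤ q.eval (2 * (enc a).length + 1) := by
    simpa only [size_symbs, List.length_reverse] using h2
  simp only [Equiv.invFun_as_coe, Equiv.refl_symm]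
  erw [List.map_id, List.map_id]
  refine outputs_symb h3 ?_
  simp [size_symbs]
  omega

theorem tm2ComputableInPolyTime_bool {α : Type} {enc : α → List Symb}
    {F : α → Bool} {g : List Symb → Bool} (hg : PolyTime g) (h : ∀ a, g (enc a) = F a) :
    Nonempty (TM2ComputableInPolyTime enc encodeBool F) := by
  obtain ⟨p, q, hp⟩ := comp hg (list_reverse PolyTime.id)
  refine ⟨{
    tm := machine (.seq readInput (.seq p writeBool)) .outBool
    inputAlphabet := Equiv.refl _
    outputAlphabet := Equiv.refl _
    time := 4 * .X + q.comp (2 * .X + 1) + 7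
    outputsFun := fun a => Classical.choice ?_ }⟩
  have h1 := ((hp (enc a).reverse).1 [])
  simp only [List.reverse_reverse, List.append_nil, h] at h1
  have h3 := (runsIn_readInput (enc a)).seq (h1.seq (runsIn_writeBool _))
  simp only [Equiv.invFun_as_coe, Equiv.refl_symm]
  erw [List.map_id, List.map_id]
  refine outputs_bool h3 ?_
  simp [size_symbs]
  omega

end PolyTime

/-! ### Binary numbers -/

/-- The value of a binary number, least significant bit first. -/
def bitsVal : List Bool → ℕ
  | [] => 0
  | b :: l => b.toNat + 2 * bitsVal l

theorem bitsVal_append_singleton (l : List Bool) (b : Bool) :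
    bitsVal (l ++ [b]) = bitsVal l + 2 ^ l.length * b.toNat := by
  induction l with
  | nil => simp [bitsVal]
  | cons a l ih => simp [bitsVal, ih, pow_succ]; ring

theorem bitsVal_eq_headD_add (l : List Bool) :
    bitsVal l = (l.headD false).toNat + 2 * bitsVal l.tail := by
  cases l <;> rfl

theorem bitsVal_encodeNat (n : ℕ) : bitsVal (encodeNat n) = n := by
  have key : ∀ p : PosNum, bitsVal (encodePosNum p) = (p : ℕ) := by
    intro p
    induction p with
    | one => simp [encodePosNum, bitsVal]
    | bit1 p ih => simp [encodePosNum, bitsVal, ih]; ring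
    | bit0 p ih => simp [encodePosNum, bitsVal, ih]; ring
  unfold encodeNat
  conv_rhs => rw [← Num.to_of_nat n]
  cases (n : Num) with
  | zero => rfl
  | pos p => exact key p

/-- One step of the addition of binary numbers; the state consists of the remaining digits of the
summands, the carry, and the digits found so far. -/
def addBitsStep (s : (List Bool × List Bool) × (Bool × List Bool)) :
    (List Bool × List Bool) × (Bool × List Bool) :=
  ((s.1.1.tail, s.1.2.tail),
    ((s.1.1.headD false && s.1.2.headD false) ||
      (s.2.1 && (s.1.1.headD false).xor (s.1.2.headD false)),
    s.2.2 ++ [((s.1.1.headD false).xor (s.1.2.headD false)).xor s.2.1]))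

/-- Addition of binary numbers. -/
def addBits (a b : List Bool) : List Bool :=
  let s := (a ++ b).foldl (fun s _ => addBitsStep s) ((a, b), (false, []))
  s.2.2 ++ [s.2.1]

/-- `t` is merely a clock: it is long enough to exhaust both summands, whose missing digits are read
as `false`. The invariant gives the carry and the remaining summands the weight `2 ^ u.length`. -/
theorem foldl_addBitsStep (t a b : List Bool) (c : Bool) (u : List Bool) (ha : a.length ≤ t.length)
    (hb : b.length ≤ t.length) :
    let s := t.foldl (fun s _ => addBitsStep s) ((a, b), (c, u))
    bitsVal (s.2.2 ++ [s.2.1]) = bitsVal u + 2 ^ u.length * (bitsVal a + bitsVal b + c.toNat) ∧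
      s.2.2.length = u.length + t.length := by
  induction t generalizing a b c u with
  | nil =>
    simp at ha hb
    simp [ha, hb, bitsVal, bitsVal_append_singleton]
  | cons x t ih =>
    have hs : addBitsStep ((a, b), (c, u)) = ((a.tail, b.tail),
        ((a.headD false && b.headD false) || (c && (a.headD false).xor (b.headD false)),
          u ++ [((a.headD false).xor (b.headD false)).xor c])) := rfl
    simp only [List.foldl_cons, hs]
    refine (ih a.tail b.tail _ _ (by simp at ha ⊢; omega) (by simp at hb ⊢; omega)).imp
      (fun h => ?_) fun h => by rw [h]; simp; omega
    rw [h, bitsVal_append_singleton, bitsVal_eq_headD_add a, bitsVal_eq_headD_add b,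
      List.length_append, List.length_singleton, pow_succ]
    cases a.headD false <;> cases b.headD false <;> cases c <;> simp <;> ring

theorem bitsVal_addBits (a b : List Bool) : bitsVal (addBits a b) = bitsVal a + bitsVal b := by
  have h := (foldl_addBitsStep (a ++ b) a b false [] (by simp) (by simp)).1
  simpa [bitsVal, addBits] using h

theorem length_addBits (a b : List Bool) : (addBits a b).length = a.length + b.length + 1 := by
  have h := (foldl_addBitsStep (a ++ b) a b false [] (by simp) (by simp)).2
  simpa [addBits] using h

/-- One step of the comparison of binary numbers; the state consists of the remaining digits and
the result of the comparison of the digits read so far. -/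
def leBitsStep (s : (List Bool × List Bool) × Bool) : (List Bool × List Bool) × Bool :=
  ((s.1.1.tail, s.1.2.tail),
    bif (s.1.1.headD false).xor (s.1.2.headD false) then s.1.2.headD false else s.2)

/-- Comparison of binary numbers. -/
def leBits (a b : List Bool) : Bool :=
  ((a ++ b).foldl (fun s _ => leBitsStep s) ((a, b), true)).2

/-- The least significant digits come first, so a later difference overrides the verdict `c`, which
survives only if the remaining digits agree. -/
theorem foldl_leBitsStep (t a b : List Bool) (c : Bool) (ha : a.length ≤ t.length)
    (hb : b.length ≤ t.length) :
    (t.foldl (fun s _ => leBitsStep s) ((a, b), c)).2 = true ↔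
      bitsVal a < bitsVal b ∨ bitsVal a = bitsVal b ∧ c = true := by
  induction t generalizing a b c with
  | nil =>
    simp at ha hb
    simp [ha, hb, bitsVal]
  | cons x t ih =>
    have hs : leBitsStep ((a, b), c) = ((a.tail, b.tail),
        bif (a.headD false).xor (b.headD false) then b.headD false else c) := rfl
    rw [List.foldl_cons, hs, ih a.tail b.tail _ (by simp at ha ⊢; omega) (by simp at hb ⊢; omega), bitsVal_eq_headD_add a,
      bitsVal_eq_headD_add b]
    cases a.headD false <;> cases b.headD false <;> simp <;> omega

theorem leBits_iff (a b : List Bool) : leBits a b = true ↔ bitsVal a ≤ bitsVal b := by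
  rw [leBits, foldl_leBitsStep _ _ _ _ (by simp) (by simp)]
  simp [le_iff_lt_or_eq]

/-- Costs: a flag for `∞`, and a binary number. -/
abbrev CostRep : Type := Bool × List Bool

namespace CostRep

/-- The represented cost. -/
def val (c : CostRep) : ℕ∞ := bif c.1 then ⊤ else (bitsVal c.2 : ℕ∞)

/-- If the flag is set, the digits are meaningless, so they may be added regardless. -/
def add (c c' : CostRep) : CostRep := (c.1 || c'.1, addBits c.2 c'.2)

def le (c c' : CostRep) : Bool := c'.1 || (!c.1 && leBits c.2 c'.2)

theorem val_add (c c' : CostRep) : (c.add c').val = c.val + c'.val := by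
  obtain ⟨_ | _, c⟩ := c <;> obtain ⟨_ | _, c'⟩ := c' <;> simp [add, val, bitsVal_addBits]

theorem le_iff (c c' : CostRep) : c.le c' = true ↔ c.val ≤ c'.val := by
  obtain ⟨_ | _, c⟩ := c <;> obtain ⟨_ | _, c'⟩ := c' <;> simp [le, val, leBits_iff]

end CostRep

theorem TreeCode.size_tail_le (l : List α) : size l.tail ≤ size l := by
  cases l with
  | nil => exact le_rfl
  | cons a l => simp only [List.tail_cons, size_cons]; omega

theorem TreeCode.size_bits (w : List Bool) : size w = 2 * w.length + 1 := by
  induction w with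
  | nil => rfl
  | cons s w ih => simp [ih]; ring

namespace PolyTime

@[fun_prop]
theorem addBits {f g : α → List Bool} (hf : PolyTime f) (hg : PolyTime g) :
    PolyTime fun a => addBits (f a) (g a) := by
  have h := list_foldl_of_le_add (l := fun p : List Bool × List Bool => p.1 ++ p.2)
    (i := fun p => (p, (false, []))) (step := fun _ s _ => addBitsStep s) (by fun_prop)
    (by fun_prop) (by unfold addBitsStep; fun_prop) 2 (fun a c b => by
      obtain ⟨⟨x, y⟩, z, u⟩ := c
      have := size_append u [((x.headD false).xor (y.headD false)).xor z]
      have h1 : size x.tail ≤ size x := size_tail_le x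
      have h2 : size y.tail ≤ size y := size_tail_le y
      simp [addBitsStep] at *
      omega)
  exact comp (g := fun p : List Bool × List Bool => _root_.addBits p.1 p.2)
    (by unfold _root_.addBits; fun_prop) (hf.prodMk hg)

@[fun_prop]
theorem leBits {f g : α → List Bool} (hf : PolyTime f) (hg : PolyTime g) :
    PolyTime fun a => leBits (f a) (g a) := by
  have h := list_foldl_of_le_add (l := fun p : List Bool × List Bool => p.1 ++ p.2)
    (i := fun p => (p, true)) (step := fun _ s _ => leBitsStep s) (by fun_prop)
    (by fun_prop) (by unfold leBitsStep; fun_prop) 0 (fun a c b => by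
      obtain ⟨⟨x, y⟩, z⟩ := c
      have h1 : size x.tail ≤ size x := size_tail_le x
      have h2 : size y.tail ≤ size y := size_tail_le y
      simp [leBitsStep] at *
      omega)
  exact comp (g := fun p : List Bool × List Bool => _root_.leBits p.1 p.2)
    (by unfold _root_.leBits; fun_prop) (hf.prodMk hg)

@[fun_prop]
theorem costRep_add {f g : α → CostRep} (hf : PolyTime f) (hg : PolyTime g) :
    PolyTime fun a => (f a).add (g a) := by
  unfold CostRep.add
  fun_prop

@[fun_prop]
theorem costRep_le {f g : α → CostRep} (hf : PolyTime f) (hg : PolyTime g) :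
    PolyTime fun a => (f a).le (g a) := by
  unfold CostRep.le
  fun_prop

@[fun_prop]
theorem nat_mul {f g : α → ℕ} (hf : PolyTime f) (hg : PolyTime g) :
    PolyTime fun a => f a * g a := by
  have h : PolyTime fun a => ((List.replicate (f a) Symb.mark).flatMap fun _ =>
      List.replicate (g a) Symb.mark).length := by fun_prop
  simpa using h

end PolyTime

/-! ### Dynamic programming -/

/-- Triples of scores. -/
abbrev ScoreTriple : Type := ℕ × ℕ × ℕ

/-- A partial bribery: the scores and the cost that it leads to, and its code. -/
abbrev Entry : Type := ScoreTriple × CostRep × List Symb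

namespace Entry

/-- The sum of the scores and costs, and the concatenation of the codes. -/
def append (e e' : Entry) : Entry :=
  ((e.1.1 + e'.1.1, e.1.2.1 + e'.1.2.1, e.1.2.2 + e'.1.2.2), e.2.1.add e'.2.1, e.2.2 ++ e'.2.2)

def hasScores (e : Entry) (s : ScoreTriple) : Bool :=
  decide (e.1.1 = s.1) && (decide (e.1.2.1 = s.2.1) && decide (e.1.2.2 = s.2.2))

theorem hasScores_iff (e : Entry) (s : ScoreTriple) : e.hasScores s = true ↔ e.1 = s := by
  simp [hasScores, Prod.ext_iff]

/-- An entry of minimum cost, if there is any entry. -/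
def cheapest (l : List Entry) : List Entry :=
  l.foldl (fun acc e => acc.split [e] fun b _ => bif b.2.1.le e.2.1 then [b] else [e]) []

/-- The table for one more voter with the given options. -/
def tableStep (keys : List ScoreTriple) (T os : List Entry) : List Entry :=
  keys.flatMap fun s => cheapest ((T.flatMap fun e => os.map fun o => e.append o).filter fun e =>
    e.hasScores s)

/-- The cheapest choices of one option for each voter, one for each triple of scores. -/
def table (keys : List ScoreTriple) (opts : List (List Entry)) : List Entry :=
  opts.foldl (tableStep keys) [((0, 0, 0), (false, []), [])]

/-- Induction from the right end, since the fold runs from the left: the accumulator is empty or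
holds a single minimum of the entries seen so far. -/
theorem cheapest_spec (l : List Entry) :
    (l = [] ∧ cheapest l = []) ∨
      ∃ e ∈ l, cheapest l = [e] ∧ ∀ e' ∈ l, e.2.1.val ≤ e'.2.1.val := by
  induction l using List.reverseRecOn with
  | nil => simp [cheapest]
  | append_singleton l a ih =>
    right
    have h : cheapest (l ++ [a]) =
        (cheapest l).split [a] fun b _ => bif b.2.1.le a.2.1 then [b] else [a] := by
      simp [cheapest]
    rcases ih with ⟨rfl, h'⟩ | ⟨e, he, h', hmin⟩
    · exact ⟨a, by simp, by rw [h, h']; rfl, by simp⟩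
    · rw [h, h']
      simp only [List.split]
      cases hle : e.2.1.le a.2.1
      · have hlt : a.2.1.val < e.2.1.val := by
          rw [← not_le, ← CostRep.le_iff, hle]; simp
        refine ⟨a, by simp, rfl, fun e' he' => ?_⟩
        rcases List.mem_append.1 he' with he' | he'
        · exact hlt.le.trans (hmin e' he')
        · rw [List.mem_singleton.1 he']
      · refine ⟨e, by simp [he], rfl, fun e' he' => ?_⟩
        rcases List.mem_append.1 he' with he' | he'
        · exact hmin e' he'
        · rw [List.mem_singleton.1 he', ← CostRep.le_iff, hle]

theorem mem_of_mem_cheapest {l : List Entry} {e : Entry} (h : e ∈ cheapest l) :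
    e ∈ l ∧ ∀ e' ∈ l, e.2.1.val ≤ e'.2.1.val := by
  rcases cheapest_spec l with ⟨_, h'⟩ | ⟨e', he', h', hmin⟩
  · simp [h'] at h
  · rw [h', List.mem_singleton] at h
    subst h
    exact ⟨he', hmin⟩

theorem exists_mem_cheapest {l : List Entry} {e : Entry} (h : e ∈ l) :
    ∃ e' ∈ cheapest l, e'.2.1.val ≤ e.2.1.val := by
  rcases cheapest_spec l with ⟨rfl, _⟩ | ⟨e', he', h', hmin⟩
  · simp at h
  · exact ⟨e', by simp [h'], hmin e h⟩

theorem length_cheapest_le (l : List Entry) : (cheapest l).length ≤ 1 := by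
  rcases cheapest_spec l with ⟨_, h'⟩ | ⟨e', he', h', hmin⟩ <;> simp [h']

/-- Subadditivity keeps entry sizes linear in the number of voters. The additional digit produced by
`addBits` is paid for by the node tokens that two entries have and one entry lacks. -/
theorem size_append_le (e e' : Entry) : size (e.append e') ≤ size e + size e' := by
  obtain ⟨⟨x, y, z⟩, ⟨b, c⟩, w⟩ := e
  obtain ⟨⟨x', y', z'⟩, ⟨b', c'⟩, w'⟩ := e'
  have := size_append w w'
  simp [append, CostRep.add, size_bits, length_addBits] at *
  omega

theorem mem_tableStep {keys : List ScoreTriple} {T os : List Entry} {e : Entry}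
    (h : e ∈ tableStep keys T os) : ∃ e₁ ∈ T, ∃ o ∈ os, e = e₁.append o := by
  simp only [tableStep, List.mem_flatMap] at h
  obtain ⟨s, _, h⟩ := h
  have h := (mem_of_mem_cheapest h).1
  simp only [List.mem_filter, List.mem_flatMap, List.mem_map] at h
  obtain ⟨⟨e₁, he₁, o, ho, rfl⟩, _⟩ := h
  exact ⟨e₁, he₁, o, ho, rfl⟩

/-- Completeness of one step: `e.append o` passes the filter for its own key, so the entry kept for
that key costs no more. -/
theorem exists_mem_tableStep {keys : List ScoreTriple} {T os : List Entry} {e o : Entry}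
    (he : e ∈ T) (ho : o ∈ os) (hk : (e.append o).1 ∈ keys) :
    ∃ e' ∈ tableStep keys T os, e'.1 = (e.append o).1 ∧ e'.2.1.val ≤ (e.append o).2.1.val := by
  have h : e.append o ∈ (T.flatMap fun e => os.map fun o => e.append o).filter fun e' =>
      e'.hasScores (e.append o).1 := by
    simp only [List.mem_filter, List.mem_flatMap, List.mem_map]
    exact ⟨⟨e, he, o, ho, rfl⟩, (hasScores_iff _ _).2 rfl⟩
  obtain ⟨e', he', hle⟩ := exists_mem_cheapest h
  refine ⟨e', List.mem_flatMap.2 ⟨_, hk, he'⟩, ?_, hle⟩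
  exact (hasScores_iff _ _).1 (List.mem_filter.1 (mem_of_mem_cheapest he').1).2

theorem length_tableStep_le (keys : List ScoreTriple) (T os : List Entry) :
    (tableStep keys T os).length ≤ keys.length := by
  unfold tableStep
  induction keys with
  | nil => simp
  | cons s keys ih =>
    simp only [List.flatMap_cons, List.length_append, List.length_cons]
    have := length_cheapest_le
      ((T.flatMap fun e => os.map fun o => e.append o).filter fun e => e.hasScores s)
    omega

/-- Each step keeps at most one entry per key and lengthens an entry by at most `S`, so the table
stays polynomial although the number of briberies is exponential. The `+ 1` allows for the initial
table, which has one entry whatever the keys are. -/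
theorem size_foldl_tableStep_le (keys : List ScoreTriple) (S : ℕ) (opts : List (List Entry))
    (hS : ∀ os ∈ opts, size os ≤ S) (T : List Entry) (C : ℕ) (hT : T.length ≤ keys.length + 1)
    (hC : ∀ e ∈ T, size e ≤ C) :
    (opts.foldl (tableStep keys) T).length ≤ keys.length + 1 ∧
      ∀ e ∈ opts.foldl (tableStep keys) T, size e ≤ C + opts.length * S := by
  induction opts generalizing T C with
  | nil => exact ⟨hT, by simpa only [List.foldl_nil, List.length_nil, zero_mul, add_zero] using hC⟩
  | cons os opts ih =>
    have h := ih (fun os' h => hS os' (by simp [h])) (tableStep keys T os) (C + S)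
      ((length_tableStep_le _ _ _).trans (by omega)) (fun e he => by
        obtain ⟨e₁, he₁, o, ho, rfl⟩ := mem_tableStep he
        have := size_append_le e₁ o
        have := hC e₁ he₁
        have := (size_lt_of_mem ho).trans_le (hS os (by simp))
        omega)
    refine ⟨h.1, fun e he => (h.2 e he).trans (le_of_eq ?_)⟩
    simp only [List.length_cons]
    ring

end Entry

namespace PolyTime

@[fun_prop]
theorem entry_append {f g : α → Entry} (hf : PolyTime f) (hg : PolyTime g) :
    PolyTime fun a => (f a).append (g a) := by
  unfold Entry.append
  fun_prop

@[fun_prop]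
theorem entry_hasScores {f : α → Entry} {g : α → ScoreTriple} (hf : PolyTime f)
    (hg : PolyTime g) : PolyTime fun a => (f a).hasScores (g a) := by
  unfold Entry.hasScores
  fun_prop

@[fun_prop]
theorem entry_cheapest {f : α → List Entry} (hf : PolyTime f) :
    PolyTime fun a => Entry.cheapest (f a) := by
  refine comp (g := Entry.cheapest) ?_ hf
  refine list_foldl_of_le_add (l := fun l : List Entry => l) (i := fun _ => [])
    (step := fun _ acc e => acc.split [e] fun b _ => bif b.2.1.le e.2.1 then [b] else [e])
    (by fun_prop) (by fun_prop) ?_ (.X + 2) (fun a c b => ?_)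
  · exact list_split (l := fun p : (List Entry × List Entry) × Entry => p.1.2)
      (n := fun p => [p.2])
      (c := fun p b _ => bif b.2.1.le p.2.2.1 then [b] else [p.2]) (by fun_prop) (by fun_prop)
      (by fun_prop)
  · cases c with
    | nil => simp [List.split]; omega
    | cons e c =>
      have := one_le_size c
      cases h : e.2.1.le b.2.1 <;> simp [List.split, h] <;> omega

@[fun_prop]
theorem entry_table {keys : α → List ScoreTriple} {opts : α → List (List Entry)}
    (hk : PolyTime keys) (ho : PolyTime opts) :
    PolyTime fun a => Entry.table (keys a) (opts a) := by
  refine comp (g := fun p : List ScoreTriple × List (List Entry) => Entry.table p.1 p.2) ?_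
    (hk.prodMk ho)
  unfold Entry.table
  -- The bound is number of entries times size of an entry: at most `keys.length + 1` entries, each
  -- of the initial size plus one option per voter.
  refine list_foldl (by fun_prop) (by fun_prop) (by unfold Entry.tableStep; fun_prop)
    ((.X + 1) * (.C (size (((0, 0, 0), (false, []), []) : Entry)) + .X * .X + 1) + 1)
    (fun p l' hl' => ?_)
  have h := Entry.size_foldl_tableStep_le p.1 (size l') l' (fun os h => (size_lt_of_mem h).le)
    [((0, 0, 0), (false, []), [])] (size (((0, 0, 0), (false, []), []) : Entry)) (by simp) (by simp)
  refine (size_le_of_forall_le h.2).trans ?_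
  have h1 := length_lt_size p.1
  have h2 := size_le_of_prefix hl'
  have h3 := length_lt_size l'
  have h4 := size_prod p
  have h5 : l'.length * size l' ≤ size p * size p := Nat.mul_le_mul (by omega) (by omega)
  simp only [Polynomial.eval_add, Polynomial.eval_mul, Polynomial.eval_X, Polynomial.eval_one,
    Polynomial.eval_C]
  exact Nat.add_le_add_right (Nat.mul_le_mul (by omega) (by omega)) 1

end PolyTime

/-! ### The algorithm -/

def Symb.isSep : Symb → Bool
  | .sep => true
  | _ => false

def Symb.isInfinity : Symb → Bool
  | .infinity => true
  | _ => false

def Symb.toBool : Symb → Bool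
  | .bit b => b
  | _ => false

/-- The blocks of a word, each of which is ended by a separator. -/
def blocks (w : List Symb) : List (List Symb) :=
  w.reverse.foldl (fun acc s => bif s.isSep then [] :: acc
    else acc.split [[s]] fun u us => (s :: u) :: us) []

/-- The cost that is written in a block. -/
def blockCost (u : List Symb) : CostRep := (u.any Symb.isInfinity, u.map Symb.toBool)

/-- The code of the integer `j - l`. -/
def diffCode (j l : ℕ) : List Symb :=
  (bif decide (j < l) then [Symb.minus] else []) ++
    (List.replicate ((j - l) + (l - j)) Symb.mark ++ [Symb.sep])

/-- The blocks from each block on whose index is a multiple of `s`. -/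
def everySuffix (s : ℕ) (l : List (List Symb)) : List (List (List Symb)) :=
  ((List.range l.length).filter fun i => decide (i * s < l.length)).map fun i => l.drop (i * s)

/-- The number in the block with index `i`. -/
def blockNat (v : List (List Symb)) (i : ℕ) : ℕ := ((v.drop i).headD []).length

/-- Whether the voter with blocks `v` approves of `c` within the top `k` positions, if she approves
of her top `j` candidates. -/
def approvesWithin (j k c : ℕ) (v : List (List Symb)) : ℕ :=
  bif (List.range j).any fun r => decide (r < k) && decide (blockNat v r = c) then 1 else 0

/-- The effects of the possible approval counts of the voter with blocks `v`. -/
def voterOptions (m d k c : ℕ) (v : List (List Symb)) : List Entry :=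
  (List.range (m + 1)).map fun j =>
    ((approvesWithin j (k + 1) c v, approvesWithin j (k + 1) d v, approvesWithin j k d v),
      blockCost ((v.drop (m + 1 + j)).headD []), diffCode j (blockNat v m))

/-- All triples of numbers up to `n`. -/
def scoreTriples (n : ℕ) : List ScoreTriple :=
  (List.range (n + 1)).flatMap fun x => (List.range (n + 1)).flatMap fun y =>
    (List.range (n + 1)).map fun z => (x, y, z)

/-- The cheapest successful bribery, for `m` candidates, despised candidate `d`, and voters `vs`.
The test `accept n b (x, y, z)` says whether scores `x` of some candidate in round `k` and `y`, `z`
of `d` in the rounds `k` and `k - 1` show that `d` does not win, where `b` says whether `k` is the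
last round. -/
def cheapestBribery (accept : ℕ → Bool → ScoreTriple → Bool) (m d : ℕ)
    (vs : List (List (List Symb))) : List Entry :=
  Entry.cheapest ((List.range m).flatMap fun k => (List.range m).flatMap fun c =>
    (Entry.table (scoreTriples vs.length) (vs.map fun v => voterOptions m d k c v)).filter fun e =>
      accept vs.length (decide (k + 1 = m)) e.1)

/-- The cheapest successful bribery for the instance with the given blocks. -/
def solveBlocks (accept : ℕ → Bool → ScoreTriple → Bool) (us : List (List Symb)) : List Entry :=
  cheapestBribery accept (blockNat us 0) (blockNat us 1)
    (everySuffix (blockNat us 0 + blockNat us 0 + 2) (us.drop 2))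

/-- The code of the answer to the search problem. -/
def searchAnswer (accept : ℕ → Bool → ScoreTriple → Bool) (w : List Symb) : List Symb :=
  (solveBlocks accept (blocks w)).split [Symb.noAnswer] fun e _ => e.2.2

/-- The answer to the decision problem. -/
def decisionAnswer (accept : ℕ → Bool → ScoreTriple → Bool) (w : List Symb) : Bool :=
  (solveBlocks accept (blocks w).tail).any fun e => e.2.1.le (blockCost ((blocks w).headD []))

/-! ### The algorithm runs in polynomial time -/

namespace PolyTime

@[fun_prop]
theorem symb_isSep {f : α → Symb} (hf : PolyTime f) : PolyTime fun a => (f a).isSep :=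
  symb_bool _ hf

@[fun_prop]
theorem symb_isInfinity {f : α → Symb} (hf : PolyTime f) : PolyTime fun a => (f a).isInfinity :=
  symb_bool _ hf

@[fun_prop]
theorem symb_toBool {f : α → Symb} (hf : PolyTime f) : PolyTime fun a => (f a).toBool :=
  symb_bool _ hf

@[fun_prop]
theorem blocks {f : α → List Symb} (hf : PolyTime f) : PolyTime fun a => blocks (f a) := by
  refine comp (g := _root_.blocks) ?_ hf
  refine list_foldl_of_le_add (l := fun w : List Symb => w.reverse) (i := fun _ => [])
    (step := fun _ acc s => bif s.isSep then [] :: acc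
      else acc.split [[s]] fun u us => (s :: u) :: us) (by fun_prop) (by fun_prop) ?_ 10
    (fun a c b => ?_)
  · refine bool_cond (by fun_prop) (by fun_prop) ?_
    exact list_split (l := fun p : (List Symb × List (List Symb)) × Symb => p.1.2)
      (n := fun p => [[p.2]]) (c := fun p u us => (p.2 :: u) :: us) (by fun_prop) (by fun_prop)
      (by fun_prop)
  · cases b.isSep
    · cases c <;> simp [List.split]
      omega
    · simp; omega

@[fun_prop]
theorem blockCost {f : α → List Symb} (hf : PolyTime f) : PolyTime fun a => blockCost (f a) := by
  unfold _root_.blockCost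
  fun_prop

@[fun_prop]
theorem diffCode {f g : α → ℕ} (hf : PolyTime f) (hg : PolyTime g) :
    PolyTime fun a => diffCode (f a) (g a) := by
  unfold _root_.diffCode
  fun_prop

@[fun_prop]
theorem everySuffix {f : α → ℕ} {l : α → List (List Symb)} (hf : PolyTime f) (hl : PolyTime l) :
    PolyTime fun a => everySuffix (f a) (l a) := by
  unfold _root_.everySuffix
  fun_prop

@[fun_prop]
theorem blockNat {l : α → List (List Symb)} {f : α → ℕ} (hl : PolyTime l) (hf : PolyTime f) :
    PolyTime fun a => blockNat (l a) (f a) := by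
  unfold _root_.blockNat
  fun_prop

@[fun_prop]
theorem approvesWithin {j k c : α → ℕ} {l : α → List (List Symb)} (hj : PolyTime j)
    (hk : PolyTime k) (hc : PolyTime c) (hl : PolyTime l) :
    PolyTime fun a => approvesWithin (j a) (k a) (c a) (l a) := by
  unfold _root_.approvesWithin
  fun_prop

@[fun_prop]
theorem voterOptions {m d k c : α → ℕ} {l : α → List (List Symb)} (hm : PolyTime m)
    (hd : PolyTime d) (hk : PolyTime k) (hc : PolyTime c) (hl : PolyTime l) :
    PolyTime fun a => voterOptions (m a) (d a) (k a) (c a) (l a) := by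
  unfold _root_.voterOptions
  fun_prop

@[fun_prop]
theorem scoreTriples {f : α → ℕ} (hf : PolyTime f) : PolyTime fun a => scoreTriples (f a) := by
  unfold _root_.scoreTriples
  fun_prop

variable {accept : ℕ → Bool → ScoreTriple → Bool}
  (ha : PolyTime fun p : ℕ × Bool × ScoreTriple => accept p.1 p.2.1 p.2.2)
include ha

theorem cheapestBribery {m d : α → ℕ} {vs : α → List (List (List Symb))} (hm : PolyTime m)
    (hd : PolyTime d) (hv : PolyTime vs) :
    PolyTime fun a => cheapestBribery accept (m a) (d a) (vs a) := by
  have ha' : PolyTime fun p : ((α × ℕ) × ℕ) × Entry =>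
      accept (vs p.1.1.1).length (decide (p.1.1.2 + 1 = m p.1.1.1)) p.2.1 :=
    comp ha (f := fun p : ((α × ℕ) × ℕ) × Entry =>
      ((vs p.1.1.1).length, decide (p.1.1.2 + 1 = m p.1.1.1), p.2.1)) (by fun_prop)
  unfold _root_.cheapestBribery
  fun_prop

theorem solveBlocks {us : α → List (List Symb)} (hu : PolyTime us) :
    PolyTime fun a => solveBlocks accept (us a) :=
  cheapestBribery ha (by fun_prop) (by fun_prop) (by fun_prop)

theorem searchAnswer : PolyTime (searchAnswer accept) := by
  have h := solveBlocks ha (us := fun w => _root_.blocks w) (by fun_prop)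
  exact list_split (n := fun _ => [Symb.noAnswer]) (c := fun _ (e : Entry) _ => e.2.2) h
    (by fun_prop) (by fun_prop)

theorem decisionAnswer : PolyTime (decisionAnswer accept) := by
  have h := solveBlocks ha (us := fun w => (_root_.blocks w).tail) (by fun_prop)
  unfold _root_.decisionAnswer
  fun_prop

end PolyTime

/-! ### When the despised candidate loses -/

namespace Election

variable {m n : ℕ} (E : Election m n)

theorem roundScore_mono (c : Fin m) {k k' : ℕ} (h : k ≤ k') :
    E.roundScore k c ≤ E.roundScore k' c :=
  Finset.card_le_card fun i hi => by
    simp only [Finset.mem_filter] at hi ⊢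
    exact ⟨hi.1, hi.2.1, hi.2.2.trans h⟩

theorem rank_le (c : Fin m) (i : Fin n) : E.rank c i ≤ m :=
  ((E.pref i).symm c).2

theorem roundScore_last (c : Fin m) : E.roundScore m c = E.approvalScore c := by
  simp [roundScore, approvalScore, E.rank_le]

theorem roundScore_le (k : ℕ) (c : Fin m) : E.roundScore k c ≤ E.roundScore m c := by
  rw [roundScore_last]
  exact Finset.card_le_card fun i hi => by
    simp only [Finset.mem_filter] at hi ⊢
    exact ⟨hi.1, hi.2.1⟩

theorem roundScore_zero (c : Fin m) : E.roundScore 0 c = 0 := by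
  simp [roundScore, rank]

/-- Free of division, so that the tests need only addition and comparison. -/
theorem hasMajority_iff (k : ℕ) (c : Fin m) :
    E.HasMajority k c ↔ n < E.roundScore k c + E.roundScore k c := by
  unfold HasMajority
  omega

theorem exists_isWinningRound_le {k : ℕ} {c : Fin m} (h : E.HasMajority k c) :
    ∃ k' ≤ k, E.IsWinningRound k' := by
  classical
  have h' : ∃ k, ∃ c, E.HasMajority k c := ⟨k, c, h⟩
  exact ⟨Nat.find h', Nat.find_min' h' ⟨c, h⟩, Nat.find_spec h', fun k hk => Nat.find_min' h' hk⟩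

/-- Scores vanish in round `0` and no longer change after round `m`, so a winning round lies in `1,
…, m`. -/
theorem IsWinningRound.exists_eq_succ {E : Election m n} {k : ℕ} (h : E.IsWinningRound k) :
    ∃ l < m, k = l + 1 := by
  obtain ⟨⟨c, hc⟩, hmin⟩ := h
  have hk : k ≠ 0 := by
    rintro rfl
    rw [hasMajority_iff, roundScore_zero] at hc
    omega
  have hm : k ≤ m := hmin ⟨c, le_trans hc (E.roundScore_le k c)⟩
  exact ⟨k - 1, by omega, by omega⟩

end Election

/-- The test `accept` tells when `d` is not a winner: `accept n b (x, y, z)` holds, for a round `k`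
and a candidate with score `x`, where `y` and `z` are the scores of `d` in the rounds `k` and
`k - 1`, and `b` tells whether `k` is the last round. -/
def DecidesLosing (R : VotingRule) (accept : ℕ → Bool → ScoreTriple → Bool) : Prop :=
  ∀ (m n : ℕ) (E : Election m n) (d : Fin m), d ∉ R m n E ↔ ∃ k < m, ∃ c : Fin m,
    accept n (decide (k + 1 = m))
      (E.roundScore (k + 1) c, E.roundScore (k + 1) d, E.roundScore k d) = true

/-- Only the last round counts, because the round-`m` score is the approval score. -/
def acceptSpav (_ : ℕ) (b : Bool) (s : ScoreTriple) : Bool := b && decide (s.2.1 < s.1)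

/-- `d` lacks a majority in round `k`, and either the rival has one there or `k` is the last round
and the rival outscores `d`. -/
def acceptSimplifiedFallback (n : ℕ) (b : Bool) (s : ScoreTriple) : Bool :=
  decide (s.2.1 + s.2.1 ≤ n) && (decide (n < s.1 + s.1) || (b && decide (s.2.1 < s.1)))

/-- The rival outscores `d` in round `k`, and either she has a majority there while `d` had none one
round before, or `k` is the last round and `d` has no majority in it. -/
def acceptFallback (n : ℕ) (b : Bool) (s : ScoreTriple) : Bool :=
  decide (s.2.1 < s.1) && ((decide (n < s.1 + s.1) && decide (s.2.2 + s.2.2 ≤ n)) ||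
    (b && decide (s.2.1 + s.2.1 ≤ n)))

theorem notMem_spav_iff {m n : ℕ} {E : Election m n} {d : Fin m} :
    d ∉ spav m n E ↔ ∃ c, E.roundScore m d < E.roundScore m c := by
  simp [spav, E.roundScore_last]

theorem decidesLosing_spav : DecidesLosing spav acceptSpav := by
  intro m n E d
  have hm := d.pos
  simp only [notMem_spav_iff, acceptSpav, Bool.and_eq_true, decide_eq_true_eq]
  constructor
  · rintro ⟨c, hc⟩
    obtain ⟨k, rfl⟩ : ∃ k, m = k + 1 := ⟨m - 1, by omega⟩
    exact ⟨k, by omega, c, rfl, hc⟩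
  · rintro ⟨k, _, c, rfl, hc⟩
    exact ⟨c, hc⟩

/-- If `d` loses, the certificate is the winning round with a majority candidate, or else the last
round with a candidate of higher approval score. Conversely, the winning round is at most `k` or at
most `m`, and by monotonicity `d` has no majority there. -/
theorem decidesLosing_simplifiedFallback :
    DecidesLosing simplifiedFallback acceptSimplifiedFallback := by
  intro m n E d
  have hm := d.pos
  simp only [simplifiedFallback, Set.mem_ofPred_eq, not_or, not_exists, not_and,
    acceptSimplifiedFallback, Bool.and_eq_true, Bool.or_eq_true, decide_eq_true_eq]
  constructor
  · rintro ⟨h1, h2⟩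
    by_cases hw : ∃ k, E.IsWinningRound k
    · obtain ⟨k, hk⟩ := hw
      have hd := h1 k hk
      obtain ⟨c, hc⟩ := hk.1
      obtain ⟨l, hl, rfl⟩ := hk.exists_eq_succ
      rw [E.hasMajority_iff] at hd hc
      exact ⟨l, hl, c, by omega, .inl hc⟩
    · obtain ⟨c, hc⟩ := notMem_spav_iff.1 (h2 (not_exists.1 hw))
      obtain ⟨k, rfl⟩ : ∃ k, m = k + 1 := ⟨m - 1, by omega⟩
      refine ⟨k, by omega, c, ?_, .inr ⟨rfl, hc⟩⟩
      by_contra hd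
      obtain ⟨l, _, hl⟩ := E.exists_isWinningRound_le
        ((E.hasMajority_iff (k + 1) d).2 (by omega))
      exact hw ⟨l, hl⟩
  · rintro ⟨k, hk, c, hd, h⟩
    rcases h with hc | ⟨rfl, hc⟩
    · obtain ⟨l, hlk, hl⟩ := E.exists_isWinningRound_le ((E.hasMajority_iff (k + 1) c).2 hc)
      refine ⟨fun l' hl' hd' => ?_, fun hw => absurd hl (hw l)⟩
      rw [hl'.unique hl, E.hasMajority_iff] at hd'
      have := E.roundScore_mono d hlk
      omega
    · refine ⟨fun l' hl' hd' => ?_, fun hw => notMem_spav_iff.2 ⟨c, hc⟩⟩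
      rw [E.hasMajority_iff] at hd'
      have := E.roundScore_le l' d
      omega

/-- If `d` loses, the winning round or else the last round serves as certificate. Conversely, if the
winning round precedes the certified `k`, then `d` lacks a majority in it and is beaten by a
candidate who has one. -/
theorem decidesLosing_fallback : DecidesLosing fallback acceptFallback := by
  intro m n E d
  have hm := d.pos
  simp only [fallback, Set.mem_ofPred_eq, not_or, not_exists, not_and, not_forall, not_le,
    acceptFallback, Bool.and_eq_true, Bool.or_eq_true, decide_eq_true_eq]
  constructor
  · rintro ⟨h1, h2⟩
    by_cases hw : ∃ k, E.IsWinningRound k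
    · obtain ⟨k, hk⟩ := hw
      obtain ⟨c, hc⟩ := h1 k hk
      obtain ⟨l, hl, rfl⟩ := hk.exists_eq_succ
      obtain ⟨c', hc'⟩ := hk.1
      -- By minimality of the winning round `l + 1`, nobody has a majority in round `l`.
      have hd : ¬ E.HasMajority l d := fun hd => by
        have := hk.2 ⟨d, hd⟩
        omega
      rw [E.hasMajority_iff] at hd hc'
      -- The candidate who outscores `d` may lack a majority; then `d` lacks one too, and the
      -- majority candidate `c'` is the rival.
      by_cases hcm : E.HasMajority (l + 1) c
      · exact ⟨l, hl, c, hc, .inl ⟨(E.hasMajority_iff _ _).1 hcm, by omega⟩⟩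
      · rw [E.hasMajority_iff] at hcm
        exact ⟨l, hl, c', by omega, .inl ⟨hc', by omega⟩⟩
    · obtain ⟨c, hc⟩ := notMem_spav_iff.1 (h2 (not_exists.1 hw))
      obtain ⟨k, rfl⟩ : ∃ k, m = k + 1 := ⟨m - 1, by omega⟩
      refine ⟨k, by omega, c, hc, .inr ⟨rfl, ?_⟩⟩
      by_contra hd
      obtain ⟨l, _, hl⟩ := E.exists_isWinningRound_le
        ((E.hasMajority_iff (k + 1) d).2 (by omega))
      exact hw ⟨l, hl⟩
  · rintro ⟨k, hk, c, hcd, h⟩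
    rcases h with ⟨hc, hd⟩ | ⟨rfl, hd⟩
    · obtain ⟨l, hlk, hl⟩ := E.exists_isWinningRound_le ((E.hasMajority_iff (k + 1) c).2 hc)
      refine ⟨fun l' hl' => ?_, fun hw => absurd hl (hw l)⟩
      obtain rfl := hl'.unique hl
      -- The winning round is either the certified round, where `c` beats `d`, or earlier, where `d`
      -- has no majority because she has none in round `k`.
      rcases hlk.eq_or_lt with rfl | hlt
      · exact ⟨c, hcd⟩
      · obtain ⟨c', hc'⟩ := hl.1
        rw [E.hasMajority_iff] at hc'
        have := E.roundScore_mono d (Nat.le_of_lt_succ hlt)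
        exact ⟨c', by omega⟩
    · refine ⟨fun l' hl' => ?_, fun hw => notMem_spav_iff.2 ⟨c, hcd⟩⟩
      obtain ⟨c', hc'⟩ := hl'.1
      rw [E.hasMajority_iff] at hc'
      have := E.roundScore_le l' d
      exact ⟨c', by omega⟩

/-! ### The table of cheapest choices -/

namespace Entry

theorem sum_foldl_append (os : List Entry) (e : Entry) :
    (os.foldl append e).1 = (e.1.1 + (os.map (·.1.1)).sum, e.1.2.1 + (os.map (·.1.2.1)).sum,
      e.1.2.2 + (os.map (·.1.2.2)).sum) ∧
    (os.foldl append e).2.1.val = e.2.1.val + (os.map (·.2.1.val)).sum ∧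
    (os.foldl append e).2.2 = e.2.2 ++ os.flatMap (·.2.2) := by
  induction os generalizing e with
  | nil => simp
  | cons o os ih =>
    obtain ⟨h1, h2, h3⟩ := ih (e.append o)
    simp only [List.foldl_cons, h1, h2, h3]
    simp [append, CostRep.val_add, add_assoc]

/-- Soundness: every table entry comes from an actual choice of one option per voter. -/
theorem exists_of_mem_foldl_tableStep {keys : List ScoreTriple} {opts : List (List Entry)} :
    ∀ {T : List Entry} {e : Entry}, e ∈ opts.foldl (tableStep keys) T →
      ∃ e₁ ∈ T, ∃ os, List.Forall₂ (· ∈ ·) os opts ∧ e = os.foldl append e₁ := by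
  induction opts with
  | nil => intro T e he; exact ⟨e, he, [], .nil, rfl⟩
  | cons os' opts ih =>
    intro T e he
    obtain ⟨e₂, he₂, os, hos, rfl⟩ := ih he
    obtain ⟨e₁, he₁, o, ho, rfl⟩ := mem_tableStep he₂
    exact ⟨e₁, he₁, o :: os, .cons ho hos, rfl⟩

theorem mem_scoreTriples {n : ℕ} {s : ScoreTriple} :
    s ∈ scoreTriples n ↔ s.1 ≤ n ∧ s.2.1 ≤ n ∧ s.2.2 ≤ n := by
  obtain ⟨x, y, z⟩ := s
  simp [scoreTriples]

/-- Principle of optimality. Invariant along the voters: `e` is the partial sum of the given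
choices, and `e₁` is a table entry with the same scores and no higher cost; adding the same option
to both preserves this. Each option adds at most `1` to a score, so by `hn` the partial scores never
leave the keys. -/
theorem exists_mem_foldl_tableStep {n : ℕ} {os : List Entry} {opts : List (List Entry)}
    (hos : List.Forall₂ (· ∈ ·) os opts)
    (h1 : ∀ o ∈ os, o.1.1 ≤ 1 ∧ o.1.2.1 ≤ 1 ∧ o.1.2.2 ≤ 1) {T : List Entry} {e e₁ : Entry}
    (he₁ : e₁ ∈ T) (hs : e₁.1 = e.1) (hc : e₁.2.1.val ≤ e.2.1.val)
    (hn : e.1.1 + os.length ≤ n ∧ e.1.2.1 + os.length ≤ n ∧ e.1.2.2 + os.length ≤ n) :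
    ∃ e' ∈ opts.foldl (tableStep (scoreTriples n)) T,
      e'.1 = (os.foldl append e).1 ∧ e'.2.1.val ≤ (os.foldl append e).2.1.val := by
  induction hos generalizing T e e₁ with
  | nil => exact ⟨e₁, he₁, hs, hc⟩
  | @cons o os' os opts ho hos ih =>
    obtain ⟨ho1, ho2, ho3⟩ := h1 o (by simp)
    have hs' : (e₁.append o).1 = (e.append o).1 := by simp [append, hs]
    simp only [List.length_cons] at hn
    obtain ⟨e₂, he₂, hs₂, hc₂⟩ := exists_mem_tableStep (keys := scoreTriples n) he₁ ho (by
      rw [hs', mem_scoreTriples]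
      simp only [append]
      omega)
    refine ih (fun o' ho' => h1 o' (by simp [ho'])) he₂ (hs₂.trans hs') (hc₂.trans ?_) ?_
    · simp only [append, CostRep.val_add]
      gcongr
    · simp only [append]
      omega

end Entry

/-! ### Reading the instance -/

theorem blocks_append {u : List Symb} (hu : ∀ s ∈ u, s.isSep = false) (w : List Symb) :
    blocks (u ++ Symb.sep :: w) = u :: blocks w := by
  unfold blocks
  simp only [List.foldl_reverse]
  induction u with
  | nil => rfl
  | cons s u ih =>
    rw [List.cons_append, List.foldr_cons, ih fun s' h => hu s' (by simp [h]), hu s (by simp)]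
    rfl

theorem blocks_flatMap {us : List (List Symb)} (h : ∀ u ∈ us, ∀ s ∈ u, s.isSep = false) :
    blocks (us.flatMap fun u => u ++ [Symb.sep]) = us := by
  induction us with
  | nil => rfl
  | cons u us ih =>
    rw [List.flatMap_cons, List.append_assoc, List.singleton_append, blocks_append (h u (by simp)),
      ih fun u' hu' => h u' (by simp [hu'])]

/-- The block of a cost. -/
noncomputable def costBlock (x : ℕ∞) : List Symb :=
  if x = ⊤ then [Symb.infinity] else (encodeNat x.toNat).map Symb.bit

theorem isSep_costBlock {x : ℕ∞} : ∀ s ∈ costBlock x, s.isSep = false := by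
  unfold costBlock
  intro s hs
  split_ifs at hs
  · rw [List.mem_singleton.1 hs]
    rfl
  · obtain ⟨b, _, rfl⟩ := List.mem_map.1 hs
    rfl

theorem val_blockCost_costBlock (x : ℕ∞) : (blockCost (costBlock x)).val = x := by
  by_cases h : x = ⊤
  · simp [costBlock, h, blockCost, CostRep.val, Symb.isInfinity]
  · have h1 : ((encodeNat x.toNat).map Symb.bit).any Symb.isInfinity = false := by
      simp [Symb.isInfinity]
    have h2 : ((encodeNat x.toNat).map Symb.bit).map Symb.toBool = encodeNat x.toNat := by
      rw [List.map_map]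
      exact List.map_id _
    simp only [costBlock, h, if_false, blockCost, CostRep.val, h1, h2, cond_false,
      bitsVal_encodeNat]
    exact ENat.natCast_toNat h

theorem isSep_replicate_mark {k : ℕ} : ∀ s ∈ List.replicate k Symb.mark, s.isSep = false := by
  intro s hs
  rw [List.eq_of_mem_replicate hs]
  rfl

theorem diffCode_eq (j l : ℕ) : diffCode j l = encodeInt ((j : ℤ) - l) := by
  unfold diffCode encodeInt encodeUnary
  have h : ((j : ℤ) - l).natAbs = (j - l) + (l - j) := by omega
  rw [h]
  by_cases hjl : j < l
  · simp [hjl]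
  · simp [hjl]

theorem drop_mul_flatMap {ι β : Type*} {f : ι → List β} {s : ℕ} (hf : ∀ i, (f i).length = s)
    (k : ℕ) (l : List ι) : (l.flatMap f).drop (k * s) = (l.drop k).flatMap f := by
  induction k generalizing l with
  | zero => simp
  | succ k ih =>
    cases l with
    | nil => simp
    | cons i l =>
      rw [List.flatMap_cons, show (k + 1) * s = (f i).length + k * s by rw [hf]; ring,
        List.drop_append, List.drop_eq_nil_of_le (by omega), List.nil_append,
        Nat.add_sub_cancel_left, ih, List.drop_succ_cons]

theorem everySuffix_flatMap {n s : ℕ} {f : Fin n → List (List Symb)} (hs : 0 < s)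
    (hf : ∀ i, (f i).length = s) :
    everySuffix s ((List.finRange n).flatMap f) =
      (List.finRange n).map fun i : Fin n => ((List.finRange n).drop i).flatMap f := by
  have hlen : ((List.finRange n).flatMap f).length = n * s := by
    simp [List.length_flatMap, hf]
  -- Every block index is tried as a voter number; as `0 < s`, exactly those below `n` survive.
  have hfil : ((List.range (n * s)).filter fun i => decide (i * s < n * s)) = List.range n := by
    obtain ⟨k, hk⟩ := Nat.exists_eq_add_of_le (Nat.le_mul_of_pos_right n hs)
    rw [hk, List.range_add, ← hk, List.filter_append]
    have h1 : (List.range n).filter (fun i => decide (i * s < n * s)) = List.range n :=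
      List.filter_eq_self.2 fun i hi => by
        simpa using Nat.mul_lt_mul_of_pos_right (List.mem_range.1 hi) hs
    have h2 : ((List.range k).map (n + ·)).filter (fun i => decide (i * s < n * s)) = [] :=
      List.filter_eq_nil_iff.2 fun i hi => by
        obtain ⟨j, _, rfl⟩ := List.mem_map.1 hi
        simpa using Nat.mul_le_mul_right s (Nat.le_add_right n j)
    rw [h1, h2, List.append_nil]
  unfold everySuffix
  rw [hlen, hfil, ← List.map_coe_finRange_eq_range, List.map_map]
  exact List.map_congr_left fun i _ => drop_mul_flatMap hf _ _

/-! ### The blocks of an instance and the options of a voter -/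

namespace BriberyInstance

variable (I : BriberyInstance)

/-- The blocks of a voter. -/
noncomputable def voterBlocks (i : Fin I.n) : List (List Symb) :=
  (List.finRange I.m).map (fun r => List.replicate (I.election.pref i r) Symb.mark) ++
    (List.replicate (I.election.approval i) Symb.mark ::
      (List.range (I.m + 1)).map
        fun j : ℕ => costBlock (I.cost i ((j : ℤ) - (I.election.approval i : ℤ))))

/-- The blocks of the instance. -/
noncomputable def instanceBlocks : List (List Symb) :=
  List.replicate I.m Symb.mark :: List.replicate I.despised Symb.mark ::
    (List.finRange I.n).flatMap I.voterBlocks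

theorem encodeInstance_eq :
    encodeInstance I = I.instanceBlocks.flatMap fun u => u ++ [Symb.sep] := by
  simp only [encodeInstance, instanceBlocks, List.flatMap_cons, List.append_assoc, encodeUnary,
    List.flatMap_assoc]
  congr 4
  refine congrArg (fun f => List.flatMap f _) (funext fun i => ?_)
  simp [encodeVoter, voterBlocks, encodeUnary, encodeCost, costBlock, List.flatMap_map,
    List.flatMap_assoc]

theorem isSep_instanceBlocks : ∀ u ∈ I.instanceBlocks, ∀ s ∈ u, s.isSep = false := by
  intro u hu
  simp only [instanceBlocks, voterBlocks, List.mem_cons, List.mem_flatMap, List.mem_append,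
    List.mem_map] at hu
  rcases hu with rfl | rfl | ⟨i, _, ⟨r, _, rfl⟩ | rfl | ⟨j, _, rfl⟩⟩
  exacts [isSep_replicate_mark, isSep_replicate_mark, isSep_replicate_mark, isSep_replicate_mark,
    isSep_costBlock]

theorem blocks_encodeInstance : blocks (encodeInstance I) = I.instanceBlocks := by
  rw [encodeInstance_eq, blocks_flatMap I.isSep_instanceBlocks]

theorem blocks_encodeInstanceBudget (b : ℕ) :
    blocks (encodeInstanceBudget (I, b)) = costBlock b :: I.instanceBlocks := by
  have h : encodeInstanceBudget (I, b) =
      (costBlock b :: I.instanceBlocks).flatMap fun u => u ++ [Symb.sep] := by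
    rw [List.flatMap_cons, ← encodeInstance_eq]
    rfl
  rw [h, blocks_flatMap]
  intro u hu
  rcases List.mem_cons.1 hu with rfl | hu
  exacts [isSep_costBlock, I.isSep_instanceBlocks u hu]

theorem length_voterBlocks (i : Fin I.n) : (I.voterBlocks i).length = I.m + I.m + 2 := by
  simp [voterBlocks]
  omega

/-- The blocks of the voter `i` and of all voters after her. -/
noncomputable def voterSuffix (i : Fin I.n) : List (List Symb) :=
  ((List.finRange I.n).drop i).flatMap I.voterBlocks

/-- The suffix need not be cut off: only its first `2m + 2` blocks are read, and these belong to
voter `i`. -/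
theorem voterSuffix_eq (i : Fin I.n) : ∃ w, I.voterSuffix i = I.voterBlocks i ++ w := by
  have h : (i : ℕ) < (List.finRange I.n).length := by simp
  refine ⟨((List.finRange I.n).drop (i + 1)).flatMap I.voterBlocks, ?_⟩
  rw [voterSuffix, List.drop_eq_getElem_cons h, List.flatMap_cons, List.getElem_finRange]
  rfl

theorem headD_drop_append {β : Type*} (u w : List β) (x : β) {k : ℕ} (hk : k < u.length) :
    ((u ++ w).drop k).headD x = u[k] := by
  rw [List.headD_eq_head?_getD, List.head?_drop, List.getElem?_append_left hk,
    List.getElem?_eq_getElem hk]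
  rfl

theorem blockNat_voterSuffix (i : Fin I.n) (r : Fin I.m) :
    blockNat (I.voterSuffix i) r = I.election.pref i r := by
  obtain ⟨w, hw⟩ := I.voterSuffix_eq i
  rw [blockNat, hw, headD_drop_append _ _ _ (by rw [length_voterBlocks]; omega)]
  simp [voterBlocks, List.getElem_append_left]

theorem blockNat_voterSuffix_last (i : Fin I.n) :
    blockNat (I.voterSuffix i) I.m = I.election.approval i := by
  obtain ⟨w, hw⟩ := I.voterSuffix_eq i
  rw [blockNat, hw, headD_drop_append _ _ _ (by rw [length_voterBlocks]; omega)]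
  simp [voterBlocks, List.getElem_append_right]

theorem costBlock_voterSuffix (i : Fin I.n) {j : ℕ} (hj : j ≤ I.m) :
    ((I.voterSuffix i).drop (I.m + 1 + j)).headD [] =
      costBlock (I.cost i ((j : ℤ) - (I.election.approval i : ℤ))) := by
  obtain ⟨w, hw⟩ := I.voterSuffix_eq i
  rw [hw, headD_drop_append _ _ _ (by rw [length_voterBlocks]; omega)]
  simp only [voterBlocks]
  rw [List.getElem_append_right (by simp; omega)]
  simp [show I.m + 1 + j - I.m = j + 1 by omega]

theorem approvesWithin_eq (i : Fin I.n) (c : Fin I.m) (k : ℕ) {j : ℕ} (hj : j ≤ I.m) :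
    approvesWithin j k c (I.voterSuffix i) =
      if I.election.rank c i ≤ j ∧ I.election.rank c i ≤ k then 1 else 0 := by
  have h : ((List.range j).any fun r => decide (r < k) &&
      decide (blockNat (I.voterSuffix i) r = c)) =
      decide (I.election.rank c i ≤ j ∧ I.election.rank c i ≤ k) := by
    rw [Bool.eq_iff_iff]
    simp only [List.any_eq_true, List.mem_range, Bool.and_eq_true, decide_eq_true_eq]
    constructor
    · rintro ⟨r, hrj, hrk, hr⟩
      have h := I.blockNat_voterSuffix i ⟨r, by omega⟩
      simp only at h
      rw [h] at hr
      have hr' : (I.election.pref i).symm c = ⟨r, by omega⟩ := by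
        rw [Equiv.symm_apply_eq]
        exact Fin.ext hr.symm
      simp only [Election.rank, hr']
      omega
    · rintro ⟨h1, h2⟩
      refine ⟨(I.election.pref i).symm c, h1, h2, ?_⟩
      rw [blockNat_voterSuffix]
      simp
  rw [approvesWithin, h]
  split_ifs with h' <;> simp [h']

/-- The effect of the approval count `j` of voter `i`. -/
noncomputable def option (k : ℕ) (c : Fin I.m) (i : Fin I.n) (j : ℕ) : Entry :=
  ((if I.election.rank c i ≤ j ∧ I.election.rank c i ≤ k + 1 then 1 else 0,
    if I.election.rank I.despised i ≤ j ∧ I.election.rank I.despised i ≤ k + 1 then 1 else 0,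
    if I.election.rank I.despised i ≤ j ∧ I.election.rank I.despised i ≤ k then 1 else 0),
    blockCost (costBlock (I.cost i ((j : ℤ) - (I.election.approval i : ℤ)))),
    encodeInt ((j : ℤ) - (I.election.approval i : ℤ)))

theorem voterOptions_eq (k : ℕ) (c : Fin I.m) (i : Fin I.n) :
    voterOptions I.m I.despised k c (I.voterSuffix i) =
      (List.range (I.m + 1)).map (I.option k c i) := by
  refine List.map_congr_left fun j hj => ?_
  have hj : j ≤ I.m := Nat.lt_succ_iff.1 (List.mem_range.1 hj)
  simp only [approvesWithin_eq I i _ _ hj, costBlock_voterSuffix I i hj, diffCode_eq,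
    blockNat_voterSuffix_last, option]

/-- The push action that leads to the approval counts `j`. -/
def pushTo (j : Fin I.n → ℕ) : Fin I.n → ℤ := fun i => j i - I.election.approval i

theorem approval_push_pushTo {j : Fin I.n → ℕ} (hj : ∀ i, j i ≤ I.m) (i : Fin I.n) :
    (I.election.push (I.pushTo j)).approval i = j i := by
  have := hj i
  simp only [Election.push, pushTo]
  omega

theorem roundScore_push_pushTo {j : Fin I.n → ℕ} (hj : ∀ i, j i ≤ I.m) (k : ℕ) (c : Fin I.m) :
    (I.election.push (I.pushTo j)).roundScore k c =
      ∑ i, if I.election.rank c i ≤ j i ∧ I.election.rank c i ≤ k then 1 else 0 := by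
  simp only [Election.roundScore, Finset.card_filter, Election.Approves,
    I.approval_push_pushTo hj]
  rfl

/-- Every push action may be replaced by one that reaches the same approval counts directly. -/
theorem exists_pushTo (t : Fin I.n → ℤ) : ∃ j : Fin I.n → ℕ, (∀ i, j i ≤ I.m) ∧
    I.election.push (I.pushTo j) = I.election.push t ∧
      I.totalCost (I.pushTo j) ≤ I.totalCost t := by
  have hj := (I.election.push t).approval_le
  refine ⟨(I.election.push t).approval, hj, ?_, ?_⟩
  · have h := funext (I.approval_push_pushTo hj)
    simp only [Election.push] at h ⊢
    congr
  · refine Finset.sum_le_sum fun i _ => ?_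
    -- The monotonicity hypotheses start at `k = 1`; the step away from `0` uses `cost_zero` and
    -- nonnegativity.
    have hup : ∀ k l : ℕ, I.cost i k ≤ I.cost i (k + l : ℕ) := by
      intro k l
      induction l with
      | zero => rfl
      | succ l ih =>
        refine ih.trans ?_
        rcases Nat.eq_zero_or_pos (k + l) with h | h
        · rw [h, Nat.cast_zero, I.cost_zero]
          exact zero_le
        · exact_mod_cast I.cost_le_succ i ((k + l : ℕ) : ℤ) (by exact_mod_cast h)
    have hdown : ∀ k l : ℕ, I.cost i (-(k : ℤ)) ≤ I.cost i (-((k + l : ℕ) : ℤ)) := by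
      intro k l
      induction l with
      | zero => rfl
      | succ l ih =>
        refine ih.trans ?_
        rcases Nat.eq_zero_or_pos (k + l) with h | h
        · rw [h, Nat.cast_zero, neg_zero, I.cost_zero]
          exact zero_le
        · refine (I.cost_neg_le i ((k + l : ℕ) : ℤ) (by exact_mod_cast h)).trans (le_of_eq ?_)
          congr 1
          push_cast
          ring
    have hl := I.election.approval_le i
    simp only [pushTo, Election.push]
    generalize (I.election.approval i) = l at hl
    -- Since `0 ≤ l ≤ m`, clamping moves `t i` towards zero without crossing it: upwards the push is
    -- cut to at most `m - l`, downwards to at most `l`.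
    rcases le_total 0 (t i) with h | h
    · obtain ⟨k, hk⟩ := Int.eq_ofNat_of_zero_le h
      obtain ⟨k', hk'⟩ : ∃ k' : ℕ, k' ≤ k ∧
          (((max 0 (min (I.m : ℤ) (l + t i))).toNat : ℤ) - l) = k' :=
        ⟨min k (I.m - l), by omega, by omega⟩
      rw [hk'.2, hk]
      obtain ⟨d, rfl⟩ := Nat.exists_eq_add_of_le hk'.1
      exact hup k' d
    · obtain ⟨k, hk⟩ := Int.eq_ofNat_of_zero_le (neg_nonneg.2 h)
      obtain ⟨k', hk'⟩ : ∃ k' : ℕ, k' ≤ k ∧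
          (((max 0 (min (I.m : ℤ) (l + t i))).toNat : ℤ) - l) = -k' :=
        ⟨min k l, by omega, by omega⟩
      rw [hk'.2, ← neg_neg (t i), hk]
      obtain ⟨d, rfl⟩ := Nat.exists_eq_add_of_le hk'.1
      exact hdown k' d

end BriberyInstance

/-! ### Correctness -/

namespace BriberyInstance

variable (I : BriberyInstance)

/-- This ties the dynamic program to elections: scores and costs are sums over the voters, and codes
are concatenated in the same order. -/
theorem foldl_append_option {j : Fin I.n → ℕ} (hj : ∀ i, j i ≤ I.m) (k : ℕ) (c : Fin I.m) :
    (((List.finRange I.n).map fun i => I.option k c i (j i)).foldl Entry.append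
      ((0, 0, 0), (false, []), [])).1 = ((I.election.push (I.pushTo j)).roundScore (k + 1) c,
        (I.election.push (I.pushTo j)).roundScore (k + 1) I.despised,
        (I.election.push (I.pushTo j)).roundScore k I.despised) ∧
    (((List.finRange I.n).map fun i => I.option k c i (j i)).foldl Entry.append
      ((0, 0, 0), (false, []), [])).2.1.val = I.totalCost (I.pushTo j) ∧
    (((List.finRange I.n).map fun i => I.option k c i (j i)).foldl Entry.append
      ((0, 0, 0), (false, []), [])).2.2 = (List.ofFn (I.pushTo j)).flatMap encodeInt := by
  obtain ⟨h1, h2, h3⟩ := Entry.sum_foldl_append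
    ((List.finRange I.n).map fun i => I.option k c i (j i)) ((0, 0, 0), (false, []), [])
  refine ⟨h1.trans ?_, h2.trans ?_, h3.trans ?_⟩
  · simp only [I.roundScore_push_pushTo hj, List.map_map, ← Fin.sum_univ_def, zero_add]
    rfl
  · simp only [List.map_map, ← Fin.sum_univ_def, Function.comp_def, option,
      val_blockCost_costBlock]
    simp [CostRep.val, bitsVal, totalCost, pushTo]
  · rw [List.ofFn_eq_map, List.flatMap_map, List.flatMap_map, List.nil_append]
    rfl

/-- Selecting an option for every voter amounts to selecting approval counts, which is how choices
in the table become push actions. -/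
theorem forall₂_options {k : ℕ} {c : Fin I.m} {os : List Entry} :
    List.Forall₂ (· ∈ ·) os
      ((List.finRange I.n).map fun i => (List.range (I.m + 1)).map (I.option k c i)) ↔
    ∃ j : Fin I.n → ℕ, (∀ i, j i ≤ I.m) ∧
      os = (List.finRange I.n).map fun i => I.option k c i (j i) := by
  rw [List.forall₂_map_right_iff]
  constructor
  · intro h
    obtain ⟨hlen, h⟩ := List.forall₂_iff_get.1 h
    simp only [List.length_finRange] at hlen
    have h' : ∀ i : Fin I.n, ∃ j ≤ I.m, os[(i : ℕ)] = I.option k c i j := by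
      intro i
      have := h i (by omega) (by simp)
      simp only [List.get_eq_getElem, List.getElem_finRange, List.mem_map, List.mem_range] at this
      obtain ⟨j, hj, h⟩ := this
      exact ⟨j, by omega, h.symm⟩
    choose j hj hos using h'
    refine ⟨j, hj, List.ext_getElem (by simp [hlen]) fun i h1 h2 => ?_⟩
    simpa using hos ⟨i, by omega⟩
  · rintro ⟨j, hj, rfl⟩
    rw [List.forall₂_map_left_iff, List.forall₂_same]
    exact fun i _ => List.mem_map.2 ⟨j i, List.mem_range.2 (by have := hj i; omega), rfl⟩

/-- The vectors of the voters, as they are read by the algorithm. -/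
noncomputable def voterSuffixes : List (List (List Symb)) :=
  (List.finRange I.n).map I.voterSuffix

theorem solveBlocks_instanceBlocks (accept : ℕ → Bool → ScoreTriple → Bool) :
    solveBlocks accept I.instanceBlocks =
      cheapestBribery accept I.m I.despised I.voterSuffixes := by
  have h1 : blockNat I.instanceBlocks 0 = I.m := by simp [blockNat, instanceBlocks]
  have h2 : blockNat I.instanceBlocks 1 = I.despised := by simp [blockNat, instanceBlocks]
  rw [solveBlocks, h1, h2, instanceBlocks, List.drop_succ_cons, List.drop_succ_cons,
    List.drop_zero, everySuffix_flatMap (by omega) I.length_voterBlocks]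
  rfl

variable {R : VotingRule} {accept : ℕ → Bool → ScoreTriple → Bool} (hR : DecidesLosing R accept)

/-- The entries among which the algorithm selects the cheapest one. -/
noncomputable def candidateEntries (accept : ℕ → Bool → ScoreTriple → Bool) : List Entry :=
  (List.range I.m).flatMap fun k => (List.range I.m).flatMap fun c =>
    (Entry.table (scoreTriples I.voterSuffixes.length)
      (I.voterSuffixes.map fun v => voterOptions I.m I.despised k c v)).filter fun e =>
        accept I.voterSuffixes.length (decide (k + 1 = I.m)) e.1

theorem mem_candidateEntries {e : Entry} : e ∈ I.candidateEntries accept ↔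
    ∃ k < I.m, ∃ c : Fin I.m, e ∈ Entry.table (scoreTriples I.n)
      ((List.finRange I.n).map fun i => (List.range (I.m + 1)).map (I.option k c i)) ∧
        accept I.n (decide (k + 1 = I.m)) e.1 = true := by
  have h : ∀ (k : ℕ) (c : Fin I.m), (I.voterSuffixes.map fun v =>
      voterOptions I.m I.despised k c v) =
      (List.finRange I.n).map fun i => (List.range (I.m + 1)).map (I.option k c i) := by
    intro k c
    rw [voterSuffixes, List.map_map]
    exact List.map_congr_left fun i _ => I.voterOptions_eq k c i
  have hn : I.voterSuffixes.length = I.n := by simp [voterSuffixes]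
  simp only [candidateEntries, List.mem_flatMap, List.mem_range, List.mem_filter, hn]
  constructor
  · rintro ⟨k, hk, c, hc, he, ha⟩
    exact ⟨k, hk, ⟨c, hc⟩, by rwa [← h k ⟨c, hc⟩], ha⟩
  · rintro ⟨k, hk, c, he, ha⟩
    exact ⟨k, hk, c, c.2, by rwa [h k c], ha⟩

include hR

/-- Soundness: the choice behind an accepted entry has the accepted scores, which certify that `d`
loses. -/
theorem exists_prevents_of_mem_candidateEntries {e : Entry} (he : e ∈ I.candidateEntries accept) :
    ∃ t, I.Prevents R t ∧ I.totalCost t = e.2.1.val ∧ e.2.2 = (List.ofFn t).flatMap encodeInt := by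
  obtain ⟨k, hk, c, he, ha⟩ := I.mem_candidateEntries.1 he
  obtain ⟨e₁, he₁, os, hos, rfl⟩ := Entry.exists_of_mem_foldl_tableStep he
  obtain ⟨j, hj, rfl⟩ := I.forall₂_options.1 hos
  rw [List.mem_singleton] at he₁
  subst he₁
  obtain ⟨h1, h2, h3⟩ := I.foldl_append_option hj k c
  refine ⟨I.pushTo j, ?_, h2.symm, h3⟩
  rw [h1] at ha
  exact (hR _ _ _ _).2 ⟨k, hk, c, ha⟩

/-- Completeness: after clamping, a successful bribery has a certificate `(k, c)`, and the table for
that pair holds an entry with the same scores and no higher cost. Acceptance depends on the scores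
alone. -/
theorem exists_mem_candidateEntries {t : Fin I.n → ℤ} (ht : I.Prevents R t) :
    ∃ e ∈ I.candidateEntries accept, e.2.1.val ≤ I.totalCost t := by
  obtain ⟨j, hj, hpush, hcost⟩ := I.exists_pushTo t
  rw [Prevents, ← hpush, hR] at ht
  obtain ⟨k, hk, c, ha⟩ := ht
  obtain ⟨h1, h2, h3⟩ := I.foldl_append_option hj k c
  obtain ⟨e, he, hs, hle⟩ := Entry.exists_mem_foldl_tableStep (n := I.n)
    ((I.forall₂_options (k := k) (c := c)).2 ⟨j, hj, rfl⟩) (fun o ho => by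
      obtain ⟨i, _, rfl⟩ := List.mem_map.1 ho
      simp only [option]
      split_ifs <;> simp) (T := [((0, 0, 0), (false, []), [])]) (e := ((0, 0, 0), (false, []), []))
    (by simp) rfl le_rfl (by simp)
  rw [h2] at hle
  exact ⟨e, I.mem_candidateEntries.2 ⟨k, hk, c, he, by rwa [hs, h1]⟩, hle.trans hcost⟩

theorem isOptimal_of_mem_solveBlocks {e : Entry} (he : e ∈ solveBlocks accept I.instanceBlocks) :
    ∃ t, I.IsOptimal R t ∧ I.totalCost t = e.2.1.val ∧
      e.2.2 = (List.ofFn t).flatMap encodeInt := by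
  rw [solveBlocks_instanceBlocks] at he
  obtain ⟨he, hmin⟩ := Entry.mem_of_mem_cheapest he
  obtain ⟨t, ht, hcost, hcode⟩ := I.exists_prevents_of_mem_candidateEntries hR he
  refine ⟨t, ⟨ht, fun s hs => ?_⟩, hcost, hcode⟩
  obtain ⟨e', he', hle⟩ := I.exists_mem_candidateEntries hR hs
  rw [hcost]
  exact (hmin e' he').trans hle

theorem solveBlocks_ne_nil {t : Fin I.n → ℤ} (ht : I.Prevents R t) :
    solveBlocks accept I.instanceBlocks ≠ [] := by
  obtain ⟨e, he, -⟩ := I.exists_mem_candidateEntries hR ht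
  obtain ⟨e', he', -⟩ := Entry.exists_mem_cheapest he
  rw [solveBlocks_instanceBlocks]
  exact List.ne_nil_of_mem he'

theorem exists_isCorrectAnswer :
    ∃ y, IsCorrectAnswer R I y ∧ searchAnswer accept (encodeInstance I) = encodeAnswer y := by
  rw [searchAnswer, blocks_encodeInstance]
  cases h : solveBlocks accept I.instanceBlocks with
  | nil => exact ⟨none, fun t ht => I.solveBlocks_ne_nil hR ht h, rfl⟩
  | cons e l =>
    obtain ⟨t, ht, -, hcode⟩ := I.isOptimal_of_mem_solveBlocks hR (e := e) (by simp [h])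
    exact ⟨some (List.ofFn t), ⟨t, rfl, ht⟩, hcode⟩

theorem decisionAnswer_iff (b : ℕ) :
    decisionAnswer accept (encodeInstanceBudget (I, b)) = true ↔
      DestructiveSupportBribery R (I, b) := by
  simp only [decisionAnswer, blocks_encodeInstanceBudget, List.tail_cons, List.headD_cons,
    List.any_eq_true, CostRep.le_iff, val_blockCost_costBlock, DestructiveSupportBribery]
  constructor
  · rintro ⟨e, he, hb⟩
    obtain ⟨t, ht, hcost, -⟩ := I.isOptimal_of_mem_solveBlocks hR he
    exact ⟨t, ht.1, hcost.trans_le hb⟩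
  · rintro ⟨t, ht, hb⟩
    obtain ⟨e, he⟩ := List.exists_mem_of_ne_nil _ (I.solveBlocks_ne_nil hR ht)
    obtain ⟨t', ht', hcost, -⟩ := I.isOptimal_of_mem_solveBlocks hR he
    exact ⟨e, he, hcost.symm.trans_le ((ht'.2 t ht).trans hb)⟩

end BriberyInstance

theorem polynomialTime_of_decidesLosing {R : VotingRule}
    {accept : ℕ → Bool → ScoreTriple → Bool} (hR : DecidesLosing R accept)
    (ha : PolyTime fun p : ℕ × Bool × ScoreTriple => accept p.1 p.2.1 p.2.2) :
    InP encodeInstanceBudget (DestructiveSupportBribery R) ∧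
      SolvableInPolyTime encodeInstance encodeAnswer (IsCorrectAnswer R) := by
  constructor
  · exact ⟨fun Ib => decisionAnswer accept (encodeInstanceBudget Ib),
      fun Ib => Ib.1.decisionAnswer_iff hR Ib.2,
      PolyTime.tm2ComputableInPolyTime_bool (PolyTime.decisionAnswer ha) fun _ => rfl⟩
  -- The algorithm computes only code words, so the answer function is chosen among the correct
  -- answers that have these codes.
  · choose F hF hcode using fun I : BriberyInstance => I.exists_isCorrectAnswer hR
    exact ⟨F, hF, PolyTime.tm2ComputableInPolyTime_symb (PolyTime.searchAnswer ha) hcode⟩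

theorem mainTheorem9 :
    ∀ R ∈ ({spav, simplifiedFallback, fallback} : Set VotingRule),
      InP encodeInstanceBudget (DestructiveSupportBribery R) ∧
        SolvableInPolyTime encodeInstance encodeAnswer (IsCorrectAnswer R) := by
  rintro R (rfl | rfl | rfl)
  · exact polynomialTime_of_decidesLosing decidesLosing_spav (by unfold acceptSpav; fun_prop)
  · exact polynomialTime_of_decidesLosing decidesLosing_simplifiedFallback
      (by unfold acceptSimplifiedFallback; fun_prop)
  · exact polynomialTime_of_decidesLosing decidesLosing_fallback
      (by unfold acceptFallback; fun_prop)
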